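/- Let $\mathcal A$ be a finite arrangement of affine hyperplanes in $\mathbb C^\ell$ that is central ($\bigcap_{H\in\mathcal A}H\neq\emptyset$) and of rank at least three (the codimension of $\bigcap_{H\in\mathcal A}H$ is at least $3$). Let $M=M(\mathcal A)=\mathbb C^\ell-\bigcup_{H\in\mathcal A}H$, let $x_0\in M$, and let $G=G(\mathcal A)=\pi_1(M,x_0)$. *Flats.* Let $L(\mathcal A)$ be the set of nonempty intersections of hyperplanes of $\mathcal A$ (including $\mathbb C^\ell$), with $\operatorname{rank}X=\operatorname{codim}X$. For $X\in L(\mathcal A)$ let $\mathcal A_X=\{H\in\mathcal A\mid X\subseteq H\}$, $M_X=M(\mathcal A_X)$, $G_X=\pi_1(M_X,x_0)$, and let $\rho_X\colon G\to G_X$ be induced by the inclusion $M\hookrightarrow M_X$. Let $\mathcal X$ be the set of flats of rank two and $\mathcal X_0=\{X\in\mathcal X\mid |\mathcal A_X|\ge 3\}$. For $\mathcal S\subseteq L(\mathcal A)$ put $\rho_{\mathcal S}=\prod_{X\in\mathcal S}\rho_X\colon G\to\prod_{X\in\mathcal S}G_X$; $\mathcal S$ *covers* $\mathcal A$ if $\bigcup_{X\in\mathcal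 S}\mathcal A_X=\mathcal A$. *Decomposability.* For a group $\Gamma$ let $\Gamma^1=\Gamma$, $\Gamma^{n+1}=[\Gamma^n,\Gamma]$, $\operatorname{Lie}_n(\Gamma)=\Gamma^n/\Gamma^{n+1}$ and $\Gamma^\omega=\bigcap_{n\ge1}\Gamma^n$ (the nilpotent residue). $\mathcal A$ is *decomposable* if for every field $k$ and every $n\ge3$ the map $\operatorname{Lie}(\rho_{\mathcal X})_n\otimes k\colon \operatorname{Lie}_n(G)\otimes k\to\bigl(\prod_{X\in\mathcal X}\operatorname{Lie}_n(G_X)\bigr)\otimes k$ induced by $\rho_{\mathcal X}$ is an isomorphism. *Standard generating sets.* For $X\in L(\mathcal A)$, a small ball $B_X$ is an open ball centered at a point $p_X\in X$ that lies on no hyperplane of $\mathcal A-\mathcal A_X$, such that $B_X\cap M_X\subseteq M$. For $H\in\mathcal A_X$, a meridian circle of $H$ in $B_X$ is a positively oriented boundary $\beta$ of a disk $\{q+zv : z\in\mathbb C, |z|\le1\}\subseteq B_X$, with $q\in H$ and $v$ not parallel to $H$, that misses all the other hyperplanes of $\mathcal A$. An element of $G$ is *of the form $a_{X,H}$* if it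 is represented by $\gamma\beta\gamma^{-1}$ for some such $B_X$ and $\beta$ and some path $\gamma$ in $M$ from $x_0$ to $\beta$. A *standard generating set* of $G$ is a generating set $Y=\{a_H\mid H\in\mathcal A\}$ in which each $a_H$ is of the form $a_{X,H}$ for some $X\in L(\mathcal A)$ with $X\subseteq H$. *Adaptedness.* The meet of $X,X'\in L(\mathcal A)$ is the intersection of all hyperplanes of $\mathcal A$ containing $X\cup X'$. A standard generating set $Y=\{a_H\}$ is *adapted to* $\mathcal S\subseteq L(\mathcal A)$ if for each $X$ in the closure of $\mathcal S$ under meets there are a small ball $B_X$ and a path $\gamma$ in $M$ from $x_0$ to a point of $B_X\cap M$ such that, for each $H\in\mathcal A_X$, $a_H$ is represented by $(\gamma\delta_H)\beta_H(\gamma\delta_H)^{-1}$ with $\beta_H$ a meridian circle of $H$ in $B_X$ and $\delta_H$ a path in $B_X\cap M$ from the endpoint of $\gamma$ to $\beta_H$. **Theorem.** Suppose that $\mathcal A$ is decomposable, that $\mathcal X_0$ covers $\mathcal A$, and that $G(\mathcal A)$ has a standard generating set adapted to $\mathcal X_0$. Then $\ker\bigl(\rho_{\mathcal X_0}\colon G\to\prod_{X\in\mathcal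 X_0}G_X\bigr)=G^\omega$. -/

import Mathlib

open scoped commutatorElement

/-! ### Lower central series and its associated graded abelian group -/

namespace LowerCentral

variable {G H : Type*} [Group G] [Group H]

/-- `term G i` is the `(i+1)`-st term `G^{i+1}` of the lower central series
`G = G^1 ⊇ G^2 ⊇ ⋯`, where `G^{k+1} = [G^k, G]`. -/
abbrev term (G : Type*) [Group G] (i : ℕ) : Subgroup G :=
  (⊤ : Subgroup G).lowerCentralSeries i

/-- The nilpotent residue `G^ω`, the intersection of all terms of the lower central series. -/
def nilpotentResidue (G : Type*) [Group G] : Subgroup G := ⨅ i : ℕ, term G i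

instance (i : ℕ) : ((term G (i + 1)).subgroupOf (term G i)).Normal :=
  Subgroup.Normal.subgroupOf inferInstance _

/-- The quotient `G^{i+1} / G^{i+2}`, written multiplicatively. -/
abbrev GradedQuot (G : Type*) [Group G] (i : ℕ) : Type _ :=
  term G i ⧸ (term G (i + 1)).subgroupOf (term G i)

instance (i : ℕ) : CommGroup (GradedQuot G i) :=
  { (inferInstance : Group (GradedQuot G i)) with
    mul_comm := by
      intro a b
      induction a using QuotientGroup.induction_on with
      | H a =>
        induction b using QuotientGroup.induction_on with
        | H b =>
          rw [← QuotientGroup.mk_mul, ← QuotientGroup.mk_mul, QuotientGroup.eq,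
            Subgroup.mem_subgroupOf]
          have h : ⁅(b : G)⁻¹, (a : G)⁻¹⁆ ∈ term G (i + 1) := by
            rw [term, Subgroup.lowerCentralSeries_succ]
            exact Subgroup.commutator_mem_commutator (inv_mem b.2) (Subgroup.mem_top _)
          simpa [commutatorElement_def, mul_assoc] using h }

/-- `Lie_{i+1}(G) = G^{i+1} / G^{i+2}`, as an additive abelian group. -/
abbrev Lie (G : Type*) [Group G] (i : ℕ) : Type _ := Additive (GradedQuot G i)

theorem map_term_le (f : G →* H) (i : ℕ) : (term G i).map f ≤ term H i := by
  rw [term, Subgroup.map_lowerCentralSeries]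
  induction i with
  | zero => exact le_top
  | succ i ih =>
    rw [Subgroup.lowerCentralSeries_succ, term, Subgroup.lowerCentralSeries_succ]
    exact Subgroup.commutator_mono ih le_top

/-- The homomorphism `G^{i+1} → H^{i+1}` obtained by restricting `f : G → H`. -/
def termMap (f : G →* H) (i : ℕ) : term G i →* term H i :=
  (f.comp (term G i).subtype).codRestrict (term H i)
    (fun x => map_term_le f i (Subgroup.mem_map_of_mem f x.2))

/-- The homomorphism `Lie_{i+1}(G) → Lie_{i+1}(H)` induced by `f : G → H`. -/
def lieMap (f : G →* H) (i : ℕ) : Lie G i →+ Lie H i :=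
  MonoidHom.toAdditive
    (QuotientGroup.map _ _ (termMap f i) (by
      intro x hx
      exact map_term_le f (i + 1) (Subgroup.mem_map_of_mem f hx)))

end LowerCentral

/-! ### Arrangements of affine hyperplanes in `ℂ^ℓ` -/

/-- A finite set of affine hyperplanes in `ℂ^ℓ`. -/
structure AffineArrangement (ℓ : ℕ) where
  hyperplanes : Set (AffineSubspace ℂ (EuclideanSpace ℂ (Fin ℓ)))
  finite : hyperplanes.Finite
  nonempty : ∀ H ∈ hyperplanes, (H : Set (EuclideanSpace ℂ (Fin ℓ))).Nonempty
  codim_one : ∀ H ∈ hyperplanes, Module.finrank ℂ H.direction + 1 = ℓ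

namespace AffineArrangement

variable {ℓ : ℕ} (A : AffineArrangement ℓ)

/-- The complement `M(A) = ℂ^ℓ - ⋃ H`. -/
def complement : Set (EuclideanSpace ℂ (Fin ℓ)) := {x | ∀ H ∈ A.hyperplanes, x ∉ H}

/-- The arrangement group `G(A) = π₁(M(A), x₀)`. -/
abbrev Grp (x₀ : A.complement) : Type := FundamentalGroup A.complement x₀

/-- The intersection of all hyperplanes is nonempty. -/
def IsCentral : Prop := ∃ p, ∀ H ∈ A.hyperplanes, p ∈ H

/-- The set `L(A)` of nonempty intersections of hyperplanes of `A`, including `ℂ^ℓ` itself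
(the empty intersection). -/
def flats : Set (AffineSubspace ℂ (EuclideanSpace ℂ (Fin ℓ))) :=
  {X | (X : Set (EuclideanSpace ℂ (Fin ℓ))).Nonempty ∧ ∃ B ⊆ A.hyperplanes, X = sInf B}

/-- The rank of an affine subspace is its codimension. -/
noncomputable def codim (X : AffineSubspace ℂ (EuclideanSpace ℂ (Fin ℓ))) : ℕ :=
  ℓ - Module.finrank ℂ X.direction

/-- The rank of a central arrangement: the codimension of its unique maximal flat, the
intersection of all hyperplanes. -/
noncomputable def centralRank : ℕ := codim (sInf A.hyperplanes)

/-- The localization `A_X`, the hyperplanes of `A` that contain `X`. -/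
def localization (X : AffineSubspace ℂ (EuclideanSpace ℂ (Fin ℓ))) : AffineArrangement ℓ where
  hyperplanes := {H | H ∈ A.hyperplanes ∧ X ≤ H}
  finite := A.finite.subset fun _ h => h.1
  nonempty := fun H h => A.nonempty H h.1
  codim_one := fun H h => A.codim_one H h.1

/-- The set `𝒳` of rank-two flats. -/
def rankTwoFlats : Set (AffineSubspace ℂ (EuclideanSpace ℂ (Fin ℓ))) :=
  {X | X ∈ A.flats ∧ codim X = 2}

/-- The set `𝒳₀` of rank-two flats of multiplicity at least three. -/
def multipleRankTwoFlats : Set (AffineSubspace ℂ (EuclideanSpace ℂ (Fin ℓ))) :=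
  {X | X ∈ A.rankTwoFlats ∧ 3 ≤ (A.localization X).hyperplanes.ncard}

/-- A set of flats covers `A` if each hyperplane of `A` belongs to `A_X` for some `X` in it. -/
def Covers (𝒮 : Set (AffineSubspace ℂ (EuclideanSpace ℂ (Fin ℓ)))) : Prop :=
  ∀ H ∈ A.hyperplanes, ∃ X ∈ 𝒮, H ∈ (A.localization X).hyperplanes

/-! #### The homomorphisms induced by inclusions of complements -/

/-- The inclusion `M(A) → M(A_X)`. -/
def inclusion (X : AffineSubspace ℂ (EuclideanSpace ℂ (Fin ℓ))) :
    C(A.complement, (A.localization X).complement) where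
  toFun x := ⟨x.1, fun H h => x.2 H h.1⟩
  continuous_toFun := by fun_prop

/-- The group `G(A_X) = π₁(M(A_X), x₀)`. -/
abbrev LocalGrp (x₀ : A.complement) (X : AffineSubspace ℂ (EuclideanSpace ℂ (Fin ℓ))) : Type :=
  (A.localization X).Grp (A.inclusion X x₀)

/-- The homomorphism `ρ_X : G(A) → G(A_X)` induced by inclusion. -/
noncomputable def rhoAt (x₀ : A.complement)
    (X : AffineSubspace ℂ (EuclideanSpace ℂ (Fin ℓ))) : A.Grp x₀ →* A.LocalGrp x₀ X :=
  FundamentalGroup.map (A.inclusion X) x₀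

/-- The product homomorphism `ρ_𝒮 : G(A) → ∏_{X ∈ 𝒮} G(A_X)`. -/
noncomputable def rho (x₀ : A.complement)
    (𝒮 : Set (AffineSubspace ℂ (EuclideanSpace ℂ (Fin ℓ)))) :
    A.Grp x₀ →* ((X : 𝒮) → A.LocalGrp x₀ X) :=
  MonoidHom.pi fun X => A.rhoAt x₀ X

/-! #### Decomposable arrangements -/

/-- The map `Lie(ρ_𝒳)_{i+1} : Lie_{i+1}(G) → ∏_{X ∈ 𝒳} Lie_{i+1}(G_X)`, for the set `𝒳` of all
rank-two flats. -/
noncomputable def lieRho (x₀ : A.complement) (i : ℕ) :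
    LowerCentral.Lie (A.Grp x₀) i →ₗ[ℤ]
      ((X : A.rankTwoFlats) → LowerCentral.Lie (A.LocalGrp x₀ X) i) :=
  LinearMap.pi fun X => (LowerCentral.lieMap (A.rhoAt x₀ X) i).toIntLinearMap

/-- `A` is `k`-decomposable: `Lie(ρ_𝒳)_n ⊗ k` is an isomorphism for every `n ≥ 3`. -/
def IsDecomposableOver (x₀ : A.complement) (k : Type) [Field k] : Prop :=
  ∀ n : ℕ, 3 ≤ n → Function.Bijective ((A.lieRho x₀ (n - 1)).rTensor k)

/-- `A` is decomposable: it is `k`-decomposable for every field `k`. -/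
def IsDecomposable (x₀ : A.complement) : Prop :=
  ∀ (k : Type) [Field k], A.IsDecomposableOver x₀ k

/-! #### Standard generating sets -/

/-- `p` is a generic point of the flat `X`. -/
def IsGenericPoint (X : AffineSubspace ℂ (EuclideanSpace ℂ (Fin ℓ)))
    (p : EuclideanSpace ℂ (Fin ℓ)) : Prop :=
  p ∈ X ∧ ∀ H ∈ A.hyperplanes, p ∈ H ↔ X ≤ H

/-- The ball of radius `r` centred at the generic point `p` of `X` is a small ball `B_X`:
`B_X ∩ M(A_X) ⊆ M(A)`. -/
def IsSmallBall (X : AffineSubspace ℂ (EuclideanSpace ℂ (Fin ℓ)))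
    (p : EuclideanSpace ℂ (Fin ℓ)) (r : ℝ) : Prop :=
  A.IsGenericPoint X p ∧ 0 < r ∧
    Metric.ball p r ∩ (A.localization X).complement ⊆ A.complement

/-- `β` is the positively oriented boundary circle of a flat complex disk
`{q + z v : |z| ≤ 1}` contained in `B`, which meets `H` transversely in its centre `q` only, and
misses the other hyperplanes of `A`. -/
def IsMeridianCircle (B : Set (EuclideanSpace ℂ (Fin ℓ)))
    (H : AffineSubspace ℂ (EuclideanSpace ℂ (Fin ℓ))) {y : A.complement} (β : Path y y) : Prop :=
  ∃ q v : EuclideanSpace ℂ (Fin ℓ), q ∈ H ∧ v ∉ H.direction ∧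
    (∀ z : ℂ, ‖z‖ ≤ 1 → q + z • v ∈ B ∧ ∀ K ∈ A.hyperplanes, K ≠ H → q + z • v ∉ K) ∧
    ∀ t : unitInterval,
      (β t : EuclideanSpace ℂ (Fin ℓ)) =
        q + Complex.exp (2 * Real.pi * Complex.I * ((t : ℝ) : ℂ)) • v

/-- The element of `G(A)` represented by the loop `γ β γ⁻¹`. -/
noncomputable def lasso {x₀ y : A.complement} (γ : Path x₀ y) (β : Path y y) : A.Grp x₀ :=
  FundamentalGroup.fromPath (Path.Homotopic.Quotient.mk ((γ.trans β).trans γ.symm))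

/-- `g` is an element `a_{X,H}`: it is represented by `γ β γ⁻¹`, where `β` is a meridian circle
of `H` in a small ball at a generic point of `X`, and `γ` is a path in `M(A)` from the base point
to `β`. -/
def IsMeridianAt (x₀ : A.complement) (X H : AffineSubspace ℂ (EuclideanSpace ℂ (Fin ℓ)))
    (g : A.Grp x₀) : Prop :=
  ∃ (p : EuclideanSpace ℂ (Fin ℓ)) (r : ℝ) (y : A.complement) (γ : Path x₀ y) (β : Path y y),
    A.IsSmallBall X p r ∧ A.IsMeridianCircle (Metric.ball p r) H β ∧ g = A.lasso γ β

/-- `Y = {a H | H ∈ A}` is a standard generating set of `G(A)`: it generates `G(A)`, and consists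
of one element of the form `a_{X,H}` for each `H ∈ A`. -/
def IsStandardGeneratingSet (x₀ : A.complement) (a : A.hyperplanes → A.Grp x₀) : Prop :=
  (∀ H : A.hyperplanes, ∃ X ∈ A.flats, X ≤ (H : AffineSubspace ℂ (EuclideanSpace ℂ (Fin ℓ))) ∧
      A.IsMeridianAt x₀ X H (a H)) ∧
    Subgroup.closure (Set.range a) = ⊤

/-- `Y = {a H | H ∈ A}` contains a set `S_X = {a_{X,H} | H ∈ A_X}` of local generators at `X`:
for some small ball `B_X` and some path `γ` in `M(A)` from the base point to a point of `B_X`,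
each `a H` with `H ∈ A_X` is represented by `(γ δ) β (γ δ)⁻¹`, where `β` is a meridian circle
of `H` in `B_X` and `δ` is a path from the endpoint of `γ` to `β` inside `B_X`. -/
def ContainsLocalGenerators (x₀ : A.complement) (a : A.hyperplanes → A.Grp x₀)
    (X : AffineSubspace ℂ (EuclideanSpace ℂ (Fin ℓ))) : Prop :=
  ∃ (p : EuclideanSpace ℂ (Fin ℓ)) (r : ℝ) (b : A.complement) (γ : Path x₀ b),
    A.IsSmallBall X p r ∧ (b : EuclideanSpace ℂ (Fin ℓ)) ∈ Metric.ball p r ∧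
    ∀ H : A.hyperplanes, X ≤ (H : AffineSubspace ℂ (EuclideanSpace ℂ (Fin ℓ))) →
      ∃ (y : A.complement) (δ : Path b y) (β : Path y y),
        (∀ t, (δ t : EuclideanSpace ℂ (Fin ℓ)) ∈ Metric.ball p r) ∧
        A.IsMeridianCircle (Metric.ball p r) H β ∧
        a H = A.lasso (γ.trans δ) β

/-- The meet of two flats in `L(A)`: the intersection of all hyperplanes containing both. -/
noncomputable def meet (X Y : AffineSubspace ℂ (EuclideanSpace ℂ (Fin ℓ))) :
    AffineSubspace ℂ (EuclideanSpace ℂ (Fin ℓ)) :=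
  sInf {H | H ∈ A.hyperplanes ∧ X ≤ H ∧ Y ≤ H}

/-- The meet-closure of a set of flats: the intersection of all meet-closed subsets of `L(A)`
containing it. -/
def meetClosure (𝒮 : Set (AffineSubspace ℂ (EuclideanSpace ℂ (Fin ℓ)))) :
    Set (AffineSubspace ℂ (EuclideanSpace ℂ (Fin ℓ))) :=
  ⋂₀ {C | C ⊆ A.flats ∧ 𝒮 ⊆ C ∧ ∀ X ∈ C, ∀ Y ∈ C, A.meet X Y ∈ C}

/-- The set `Y = {a H | H ∈ A}` is adapted to `𝒮`: it contains a set of local generators at each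
flat in the meet-closure of `𝒮`. -/
def IsAdaptedTo (x₀ : A.complement) (a : A.hyperplanes → A.Grp x₀)
    (𝒮 : Set (AffineSubspace ℂ (EuclideanSpace ℂ (Fin ℓ)))) : Prop :=
  ∀ X ∈ A.meetClosure 𝒮, A.ContainsLocalGenerators x₀ a X

end AffineArrangement

/-! Write `G^n` for the lower central series. One inclusion is residual nilpotence of the local
groups at multiple flats. For `X ∈ 𝒳₀`, suitable linear coordinates identify `M_X`, up to homotopy,
with the product of `ℂ*` and a finitely punctured plane. So `G_X` embeds in a product of fundamental
groups of punctured planes. Those are free, and free groups are residually nilpotent by a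
Magnus-type representation. Hence `ρ_X` kills `G^ω` (`nilpotentResidue_localGrp`).

For the other inclusion, an element `g` of the kernel is shown to lie in every `G^n` by induction on
`n`. There are two geometric inputs. First, the winding numbers about the hyperplanes are dual to
the meridian generators, so they detect `G/G^2`, and the winding number about `H` factors through
`ρ_X` whenever `X ⊆ H`. Second, shrinking `M_X` radially into a ball around a generic point of `X`
gives `s_X : G_X → G` with `ρ_X s_X` inner. For `Y ≠ X` of rank two, `ρ_Y s_X` has commutative
image, because at most one hyperplane contains both flats (`exists_section_rhoAt`).

In degree one the covering hypothesis makes all winding numbers of `g` vanish. In degree two, `e_X =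
s_X ρ_X` fixes the generators from `A_X` modulo `G^2` and kills the others. Two distinct hyperplanes
lie in exactly one common rank-two flat, so the sum of the maps induced by the `e_X` is the identity
on `G^2/G^3`, which is therefore detected locally (`mem_term_two_of_local`). In degree at least
three, decomposability speaks only about fields. The sections make `Lie_n(ρ)` a split surjection
over `ℤ`, so injectivity modulo every prime makes its kernel divisible; being finitely generated,
the kernel is zero (`injective_of_split_of_rTensor_zmod_injective`). Double points never obstruct:
their groups are abelian, so `ρ_X g` is trivial once `g ∈ G^2`. -/

/-! ### Residual nilpotence of free groups -/

section Syllables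

variable {Γ ι : Type*} [Group Γ]

/-- A word in syllables `b i ^ e` with nonzero exponents and distinct consecutive letters. -/
def IsSyllableWord (l : List (ι × ℤ)) : Prop :=
  l.IsChain (fun p q => p.1 ≠ q.1) ∧ ∀ p ∈ l, p.2 ≠ 0

/-- The element of the group spelled by a word in syllables. -/
def syllableProd (b : ι → Γ) (l : List (ι × ℤ)) : Γ := (l.map fun p => b p.1 ^ p.2).prod

theorem exists_syllableWord_mul (b : ι → Γ) {l : List (ι × ℤ)} (hl : IsSyllableWord l)
    (i : ι) (k : ℤ) :
    ∃ l', IsSyllableWord l' ∧ syllableProd b l' = b i ^ k * syllableProd b l := by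
  by_cases hk : k = 0
  · exact ⟨l, hl, by simp [hk]⟩
  rcases l with _ | ⟨⟨j, m⟩, t⟩
  · exact ⟨[(i, k)], ⟨by simp, by simpa using hk⟩, by simp [syllableProd]⟩
  by_cases hij : i = j
  · subst hij
    have ht : IsSyllableWord t := ⟨hl.1.tail, fun p hp => hl.2 p (List.mem_cons_of_mem _ hp)⟩
    by_cases hkm : k + m = 0
    · refine ⟨t, ht, ?_⟩
      simp [syllableProd, ← mul_assoc, ← zpow_add, hkm]
    · refine ⟨(i, k + m) :: t, ⟨?_, ?_⟩, ?_⟩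
      · have := hl.1
        rw [List.isChain_cons] at this ⊢
        exact this
      · intro p hp
        rcases List.mem_cons.1 hp with rfl | hp
        · exact hkm
        · exact ht.2 p hp
      · simp [syllableProd, ← mul_assoc, ← zpow_add]
  · refine ⟨(i, k) :: (j, m) :: t, ⟨?_, ?_⟩, by simp [syllableProd]⟩
    · rw [List.isChain_cons_cons]
      exact ⟨hij, hl.1⟩
    · intro p hp
      rcases List.mem_cons.1 hp with rfl | hp
      · exact hk
      · exact hl.2 p hp

theorem exists_syllableWord (b : ι → Γ) {g : Γ} (hg : g ∈ Subgroup.closure (Set.range b)) :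
    ∃ l, IsSyllableWord l ∧ syllableProd b l = g := by
  induction hg using Subgroup.closure_induction_left with
  | one => exact ⟨[], ⟨by simp, by simp⟩, by simp [syllableProd]⟩
  | mul_left x hx y hy ih =>
    obtain ⟨i, rfl⟩ := hx
    obtain ⟨l, hl, rfl⟩ := ih
    obtain ⟨l', hl', h⟩ := exists_syllableWord_mul b hl i 1
    exact ⟨l', hl', by simpa using h⟩
  | inv_mul_cancel x hx y hy ih =>
    obtain ⟨i, rfl⟩ := hx
    obtain ⟨l, hl, rfl⟩ := ih
    obtain ⟨l', hl', h⟩ := exists_syllableWord_mul b hl i (-1)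
    exact ⟨l', hl', by simpa using h⟩

end Syllables

/-! ### Congruence subgroups of a filtered ring. -/

section Filtration

variable {Γ R : Type*} [Group Γ] [Ring R] (J : ℕ → AddSubgroup R)

/-- The elements of `Γ` that a representation `φ` maps into `1 + J m`. -/
def congruenceSubgroup (hmono : Antitone J)
    (hmul : ∀ m n, ∀ x ∈ J m, ∀ y ∈ J n, x * y ∈ J (m + n)) (φ : Γ →* Rˣ) (m : ℕ) :
    Subgroup Γ where
  -- The condition on `g⁻¹` is imposed separately because `J m` is only an additive subgroup.
  carrier := {g | (φ g : R) - 1 ∈ J m ∧ (φ g⁻¹ : R) - 1 ∈ J m}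
  one_mem' := by simp
  mul_mem' := by
    have key : ∀ x y : R, x - 1 ∈ J m → y - 1 ∈ J m → x * y - 1 ∈ J m := by
      intro x y hx hy
      have h : x * y - 1 = (x - 1) * (y - 1) + (x - 1) + (y - 1) := by noncomm_ring
      rw [h]
      exact add_mem (add_mem (hmono (Nat.le_add_right m m) (hmul m m _ hx _ hy)) hx) hy
    rintro a b ⟨ha, ha'⟩ ⟨hb, hb'⟩
    refine ⟨?_, ?_⟩
    · simpa using key _ _ ha hb
    · simpa using key _ _ hb' ha'
  inv_mem' := by
    rintro a ⟨ha, ha'⟩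
    exact ⟨ha', by simpa using ha⟩

/-- If `φ` is trivial modulo `J 1`, then commuting with any element gains one step in the
filtration, since `J m * J 1` and `J 1 * J m` lie in `J (m + 1)`. -/
theorem term_le_congruenceSubgroup (hmono : Antitone J)
    (hmul : ∀ m n, ∀ x ∈ J m, ∀ y ∈ J n, x * y ∈ J (m + n)) (φ : Γ →* Rˣ)
    (htop : congruenceSubgroup J hmono hmul φ 1 = ⊤) (i : ℕ) :
    LowerCentral.term Γ i ≤ congruenceSubgroup J hmono hmul φ (i + 1) := by
  induction i with
  | zero => simp [htop]
  | succ i ih =>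
    rw [LowerCentral.term, Subgroup.lowerCentralSeries_succ, Subgroup.commutator_le]
    intro x hx y _
    have hx' := ih hx
    have h1 : ∀ g : Γ, (φ g : R) - 1 ∈ J 1 := fun g =>
      ((htop ▸ Subgroup.mem_top g : g ∈ congruenceSubgroup J hmono hmul φ 1)).1
    have hm : ∀ m, ∀ z ∈ J m, ∀ g : Γ, z * (φ g : R) ∈ J m := by
      intro m z hz g
      have h : z * (φ g : R) = z * ((φ g : R) - 1) + z := by noncomm_ring
      rw [h]
      exact add_mem (hmono (Nat.le_add_right m 1) (hmul m 1 _ hz _ (h1 g))) hz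
    -- The ring commutator of `φ a - 1` and `φ b - 1`, times a unit, is the group commutator minus
    -- one.
    have hc : ∀ a b : Γ, ((φ ⁅a, b⁆ : Rˣ) : R) - 1 =
        (((φ a : R) - 1) * ((φ b : R) - 1) - ((φ b : R) - 1) * ((φ a : R) - 1)) *
          (φ a⁻¹ : R) * (φ b⁻¹ : R) := by
      intro a b
      have h2 : ((φ a : R) - 1) * ((φ b : R) - 1) - ((φ b : R) - 1) * ((φ a : R) - 1)
          = (φ a : R) * (φ b : R) - (φ b : R) * (φ a : R) := by noncomm_ring
      rw [h2]
      have h3 : (φ b : R) * (φ a : R) * (φ a⁻¹ : R) * (φ b⁻¹ : R) = 1 := by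
        simp [mul_assoc]
      rw [sub_mul, sub_mul, h3, commutatorElement_def]
      simp [mul_assoc]
    have hcm : ∀ m, ∀ a b : Γ, (φ a : R) - 1 ∈ J m → (φ b : R) - 1 ∈ J 1 →
        ((φ ⁅a, b⁆ : Rˣ) : R) - 1 ∈ J (m + 1) ∧ ((φ ⁅b, a⁆ : Rˣ) : R) - 1 ∈ J (m + 1) := by
      intro m a b ha hb
      have h4 := hmul m 1 _ ha _ hb
      have h5 := hmul 1 m _ hb _ ha
      rw [add_comm 1 m] at h5
      refine ⟨?_, ?_⟩
      · rw [hc]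
        exact hm _ _ (hm _ _ (sub_mem h4 h5) _) _
      · rw [hc]
        exact hm _ _ (hm _ _ (sub_mem h5 h4) _) _
    have := hcm (i + 1) x y hx'.1 (h1 y)
    exact ⟨this.1, by rw [commutatorElement_inv]; exact this.2⟩

end Filtration

/-! ### A Magnus-type representation by shift operators, tailored to one word. -/

section Magnus

variable {ι : Type*} [DecidableEq ι]

/-- The operator on sequences `f : ℕ → ℤ` that shifts the entries at the positions where the
letter `i` occurs in `l`, and kills the others. -/
def letterShift (l : List (ι × ℤ)) (i : ι) : Module.End ℤ (ℕ → ℤ) where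
  toFun f k := if (l[k]?).map Prod.fst = some i then f (k + 1) else 0
  map_add' f g := by ext k; by_cases h : (l[k]?).map Prod.fst = some i <;> simp [h]
  map_smul' c f := by ext k; by_cases h : (l[k]?).map Prod.fst = some i <;> simp [h]

theorem letterShift_apply (l : List (ι × ℤ)) (i : ι) (f : ℕ → ℤ) (k : ℕ) :
    letterShift l i f k = if (l[k]?).map Prod.fst = some i then f (k + 1) else 0 := rfl

/-- A nonzero square would need the letter `i` at two consecutive positions of `l`, which
reducedness forbids. -/
theorem letterShift_mul_self {l : List (ι × ℤ)} (hl : l.IsChain (fun p q => p.1 ≠ q.1)) (i : ι) :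
    letterShift l i * letterShift l i = 0 := by
  refine LinearMap.ext fun f => funext fun k => ?_
  rw [Module.End.mul_apply, letterShift_apply, letterShift_apply]
  split_ifs with h1 h2
  · exfalso
    rw [Option.map_eq_some_iff] at h1 h2
    obtain ⟨p, hp, hpi⟩ := h1
    obtain ⟨q, hq, hqi⟩ := h2
    rw [List.getElem?_eq_some_iff] at hp hq
    obtain ⟨hk, hp⟩ := hp
    obtain ⟨hk', hq⟩ := hq
    have := List.isChain_iff_getElem.1 hl k hk'
    rw [hp, hq] at this
    exact this (hpi.trans hqi.symm)
  · rfl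
  · rfl

/-- The unipotent operator `1 + N` for an operator `N` of square zero. -/
def oneAddUnit {R : Type*} [Ring R] (N : R) (hN : N * N = 0) : Rˣ where
  val := 1 + N
  inv := 1 - N
  val_inv := by noncomm_ring; simp [hN]
  inv_val := by noncomm_ring; simp [hN]

theorem coe_oneAddUnit_zpow {R : Type*} [Ring R] (N : R) (hN : N * N = 0) (m : ℤ) :
    ((oneAddUnit N hN ^ m : Rˣ) : R) = 1 + m • N := by
  induction m using Int.induction_on with
  | zero => simp
  | succ m ih =>
    rw [zpow_add_one, Units.val_mul, ih]
    simp only [oneAddUnit, add_mul, mul_add, one_mul, mul_one, smul_mul_assoc, hN, smul_zero,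
      add_smul, one_smul]
    abel
  | pred m ih =>
    rw [zpow_sub_one, Units.val_mul, ih]
    simp only [oneAddUnit, ← Units.inv_eq_val_inv, add_mul, mul_sub,
      one_mul, mul_one, smul_mul_assoc, hN, smul_zero, sub_smul, one_smul]
    abel

/-- The operators that lower the top of the support of a sequence by at least `m`. -/
def lowering (m : ℕ) : AddSubgroup (Module.End ℤ (ℕ → ℤ)) where
  carrier := {T | ∀ d, ∀ f : ℕ → ℤ, (∀ j, d ≤ j → f j = 0) → ∀ j, d ≤ j + m → T f j = 0}
  zero_mem' := by intro d f _ j _; rfl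
  add_mem' := by
    intro S T hS hT d f hf j hj
    simp [hS d f hf j hj, hT d f hf j hj]
  neg_mem' := by
    intro S hS d f hf j hj
    simp [hS d f hf j hj]

theorem lowering_antitone : Antitone lowering := by
  intro m n hmn T hT d f hf j hj
  exact hT d f hf j (hj.trans (by omega))

theorem mul_mem_lowering (m n : ℕ) (S : Module.End ℤ (ℕ → ℤ)) (hS : S ∈ lowering m)
    (T : Module.End ℤ (ℕ → ℤ)) (hT : T ∈ lowering n) : S * T ∈ lowering (m + n) := by
  intro d f hf j hj
  rw [Module.End.mul_apply]
  exact hS (d - n) (T f) (fun k hk => hT d f hf k (by omega)) j (by omega)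

theorem letterShift_mem_lowering (l : List (ι × ℤ)) (i : ι) : letterShift l i ∈ lowering 1 := by
  intro d f hf j hj
  rw [letterShift_apply, hf _ hj]
  simp

/-- Reading the word from the right, each syllable `1 + m • N` extends the support of the sequence
one place downwards and multiplies the new lowest entry by `m`. The induction runs over suffixes `t`
of the fixed word `l`, since the operators depend on all of `l`. -/
theorem syllableProd_apply_indicator {Γ : Type*} [Group Γ] (b : ι → Γ) (l : List (ι × ℤ))
    (φ : Γ →* (Module.End ℤ (ℕ → ℤ))ˣ)
    (hφ : ∀ i, ∀ m : ℤ, ((φ (b i) ^ m : (Module.End ℤ (ℕ → ℤ))ˣ) : Module.End ℤ (ℕ → ℤ))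
      = 1 + m • letterShift l i) (s t : List (ι × ℤ)) (hst : l = s ++ t) :
    (∀ j < s.length, (φ (syllableProd b t) : Module.End ℤ (ℕ → ℤ))
      (Pi.single l.length 1) j = 0) ∧
    (φ (syllableProd b t) : Module.End ℤ (ℕ → ℤ)) (Pi.single l.length 1) s.length
      = (t.map Prod.snd).prod := by
  induction t generalizing s with
  | nil =>
    have hs : l = s := by simpa using hst
    subst hs
    refine ⟨fun j hj => ?_, ?_⟩
    · simp [syllableProd, hj.ne]
    · simp [syllableProd]
  | cons p t ih =>
    obtain ⟨ih1, ih2⟩ := ih (s ++ [p]) (by simp [hst])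
    have hp : ∀ f, (φ (syllableProd b (p :: t)) : Module.End ℤ (ℕ → ℤ)) f
        = (φ (syllableProd b t) : Module.End ℤ (ℕ → ℤ)) f + p.2 • letterShift l p.1
          ((φ (syllableProd b t) : Module.End ℤ (ℕ → ℤ)) f) := by
      intro f
      have : syllableProd b (p :: t) = b p.1 ^ p.2 * syllableProd b t := by simp [syllableProd]
      rw [this, map_mul, map_zpow, Units.val_mul, hφ, Module.End.mul_apply]
      simp
    rw [List.length_append, List.length_singleton] at ih1 ih2
    refine ⟨fun j hj => ?_, ?_⟩
    · rw [hp, Pi.add_apply, Pi.smul_apply, letterShift_apply, ih1 j (by omega),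
        ih1 (j + 1) (by omega)]
      simp
    · have hl : (l[s.length]?).map Prod.fst = some p.1 := by simp [hst]
      rw [hp, Pi.add_apply, Pi.smul_apply, letterShift_apply, ih1 _ (by omega), ih2, if_pos hl]
      simp

end Magnus

/-- A nonempty reduced word is separated from the residue by the unipotent representation built from
that word. It sends the indicator of the position `l.length` to a sequence whose entry at `0` is the
product of the exponents, hence nonzero, while a deep commutator would give `0` there. -/
theorem nilpotentResidue_eq_bot_of_free {Γ : Type*} {ι : Type*} [Group Γ] (b : ι → Γ)
    (hgen : Subgroup.closure (Set.range b) = ⊤)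
    (hfree : ∀ (K : Type) [Group K] (u : ι → K), ∃ φ : Γ →* K, ∀ i, φ (b i) = u i) :
    LowerCentral.nilpotentResidue Γ = ⊥ := by
  classical
  rw [eq_bot_iff]
  intro g hg
  obtain ⟨l, hl, rfl⟩ := exists_syllableWord b (hgen ▸ Subgroup.mem_top g)
  rcases eq_or_ne l [] with rfl | hne
  · simp [syllableProd]
  exfalso
  obtain ⟨φ, hφ⟩ := hfree (Module.End ℤ (ℕ → ℤ))ˣ
    fun i => oneAddUnit (letterShift l i) (letterShift_mul_self hl.1 i)
  have htop : congruenceSubgroup lowering lowering_antitone mul_mem_lowering φ 1 = ⊤ := by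
    rw [eq_top_iff, ← hgen, Subgroup.closure_le]
    rintro _ ⟨i, rfl⟩
    refine ⟨?_, ?_⟩
    · rw [hφ]
      simpa [oneAddUnit] using letterShift_mem_lowering l i
    · rw [map_inv, hφ]
      have : ((oneAddUnit (letterShift l i) (letterShift_mul_self hl.1 i))⁻¹ :
          (Module.End ℤ (ℕ → ℤ))ˣ) - (1 : Module.End ℤ (ℕ → ℤ)) = - letterShift l i := by
        simp [oneAddUnit]
      rw [this]
      exact neg_mem (letterShift_mem_lowering l i)
  have hgl := (term_le_congruenceSubgroup lowering lowering_antitone mul_mem_lowering φ htop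
    l.length ((Subgroup.mem_iInf.1 hg) l.length)).1
  -- The indicator vanishes from position `l.length + 1` on, and the term of index `l.length` lowers
  -- by `l.length + 1`; this is just enough to empty position `0`.
  have h0 : ((φ (syllableProd b l) : Module.End ℤ (ℕ → ℤ)) - 1) (Pi.single l.length 1) 0 = 0 := by
    refine hgl (l.length + 1) _ (fun j hj => ?_) 0 (by omega)
    simp [show j ≠ l.length by omega]
  have h1 := (syllableProd_apply_indicator b l φ
    (fun i m => by rw [hφ]; exact coe_oneAddUnit_zpow _ _ m) [] l (by simp)).2
  have hlen : l.length ≠ 0 := by simpa using hne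
  rw [LinearMap.sub_apply, Pi.sub_apply] at h0
  rw [List.length_nil] at h1
  rw [h1] at h0
  have h2 : (l.map Prod.snd).prod = 0 := by
    simpa [Pi.single_apply, hlen.symm] using h0
  rw [List.prod_eq_zero_iff] at h2
  obtain ⟨p, hp, hp0⟩ := List.mem_map.1 h2
  exact hl.2 p hp hp0

/-! ### Brackets in the associated graded group of the lower central series -/

namespace LowerCentral

variable {G H : Type*} [Group G] [Group H]

/-- The class in `G^{i+1} / G^{i+2}` of an element of `G^{i+1}`. -/
def gradedMk (G : Type*) [Group G] (i : ℕ) : term G i →* GradedQuot G i :=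
  QuotientGroup.mk' ((term G (i + 1)).subgroupOf (term G i))

theorem gradedMk_surjective (i : ℕ) : Function.Surjective (gradedMk G i) :=
  QuotientGroup.mk'_surjective _

theorem gradedMk_eq_one_iff {i : ℕ} {x : term G i} :
    gradedMk G i x = 1 ↔ (x : G) ∈ term G (i + 1) :=
  (QuotientGroup.eq_one_iff x).trans Subgroup.mem_subgroupOf

theorem commutator_mem_term {i : ℕ} {x : G} (hx : x ∈ term G i) (y : G) :
    ⁅x, y⁆ ∈ term G (i + 1) := by
  rw [term, Subgroup.lowerCentralSeries_succ]
  exact Subgroup.commutator_mem_commutator hx (Subgroup.mem_top y)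

theorem commutator_mem_term' {i : ℕ} {x : G} (hx : x ∈ term G i) (y : G) :
    ⁅y, x⁆ ∈ term G (i + 1) := by
  rw [← commutatorElement_inv]
  exact inv_mem (commutator_mem_term hx y)

theorem term_antitone : Antitone (term G) := Subgroup.lowerCentralSeries_antitone _

theorem term_one_le_ker {K : Type*} [Group K] (f : G →* K)
    (hf : ∀ x y, Commute (f x) (f y)) : term G 1 ≤ f.ker := by
  rw [term, Subgroup.lowerCentralSeries_succ, Subgroup.commutator_le]
  intro x _ y _
  rw [MonoidHom.mem_ker, map_commutatorElement, commutatorElement_eq_one_iff_commute]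
  exact hf x y

/-- The bracket `G^{i+1} × G → G^{i+2} / G^{i+3}`, which is multiplicative in both arguments. -/
def bracket (G : Type*) [Group G] (i : ℕ) : term G i →* (G →* GradedQuot G (i + 1)) where
  toFun x :=
    { toFun := fun y => gradedMk G (i + 1) ⟨⁅(x : G), y⁆, commutator_mem_term x.2 y⟩
      map_one' := by
        rw [gradedMk_eq_one_iff]
        simp
      map_mul' := by
        intro y z
        have h : (⟨⁅(x : G), y * z⁆, commutator_mem_term x.2 _⟩ : term G (i + 1)) =
            ⟨⁅(x : G), y⁆, commutator_mem_term x.2 y⟩ *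
            ⟨⁅y, ⁅(x : G), z⁆⁆, term_antitone (Nat.le_succ _)
              (commutator_mem_term' (commutator_mem_term x.2 z) y)⟩ *
            ⟨⁅(x : G), z⁆, commutator_mem_term x.2 z⟩ := by
          ext
          simp only [Subgroup.coe_mul, commutatorElement_def]
          group
        rw [h, map_mul, map_mul]
        have h1 : gradedMk G (i + 1) ⟨⁅y, ⁅(x : G), z⁆⁆, term_antitone (Nat.le_succ _)
              (commutator_mem_term' (commutator_mem_term x.2 z) y)⟩ = 1 :=
          gradedMk_eq_one_iff.2 (commutator_mem_term' (commutator_mem_term x.2 z) y)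
        rw [h1, mul_one] }
  map_one' := by
    ext y
    change gradedMk G (i + 1) _ = 1
    rw [gradedMk_eq_one_iff]
    simp
  map_mul' := by
    intro x y
    ext z
    change gradedMk G (i + 1) ⟨⁅(x : G) * (y : G), z⁆, commutator_mem_term (x * y).2 z⟩ =
      gradedMk G (i + 1) ⟨⁅(x : G), z⁆, commutator_mem_term x.2 z⟩ *
      gradedMk G (i + 1) ⟨⁅(y : G), z⁆, commutator_mem_term y.2 z⟩
    have h : (⟨⁅(x : G) * (y : G), z⁆, commutator_mem_term (x * y).2 z⟩ : term G (i + 1)) =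
        ⟨⁅(x : G), ⁅(y : G), z⁆⁆, term_antitone (Nat.le_succ _)
          (commutator_mem_term' (commutator_mem_term y.2 z) x)⟩ *
        ⟨⁅(y : G), z⁆, commutator_mem_term y.2 z⟩ *
        ⟨⁅(x : G), z⁆, commutator_mem_term x.2 z⟩ := by
      ext
      simp only [Subgroup.coe_mul, commutatorElement_def]
      group
    have h1 : gradedMk G (i + 1) ⟨⁅(x : G), ⁅(y : G), z⁆⁆, term_antitone (Nat.le_succ _)
          (commutator_mem_term' (commutator_mem_term y.2 z) x)⟩ = 1 :=
      gradedMk_eq_one_iff.2 (commutator_mem_term' (commutator_mem_term y.2 z) x)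
    rw [h, map_mul, map_mul, h1, one_mul, mul_comm]

theorem bracket_eq_one {i : ℕ} {x : term G i} (hx : (x : G) ∈ term G (i + 1)) :
    bracket G i x = 1 := by
  ext y
  exact gradedMk_eq_one_iff.2 (commutator_mem_term hx y)

/-- The quotients `G^{i+2} / G^{i+3}` are generated by brackets. -/
theorem eq_top_of_bracket_mem {i : ℕ} (Q : Subgroup (GradedQuot G (i + 1)))
    (hQ : ∀ x y, bracket G i x y ∈ Q) : Q = ⊤ := by
  have h : term G (i + 1) ≤ (Q.comap (gradedMk G (i + 1))).map (term G (i + 1)).subtype := by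
    conv_lhs => rw [term, Subgroup.lowerCentralSeries_succ]
    rw [Subgroup.commutator_le]
    intro x hx y _
    exact ⟨⟨⁅x, y⁆, commutator_mem_term hx y⟩, hQ ⟨x, hx⟩ y, rfl⟩
  rw [eq_top_iff]
  intro z _
  obtain ⟨z, rfl⟩ := gradedMk_surjective (i + 1) z
  obtain ⟨z', hz', hzz⟩ := h z.2
  have : z' = z := Subtype.ext hzz
  exact this ▸ hz'

/-- The bracket descends to a bimultiplicative map on `GradedQuot G i × G`, so brackets of
generators generate the next quotient. -/
theorem gradedQuot_fg [hG : Group.FG G] (i : ℕ) : Group.FG (GradedQuot G i) := by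
  induction i with
  | zero =>
    let q : G →* GradedQuot G 0 := (gradedMk G 0).comp (Subgroup.topEquiv (G := G)).symm.toMonoidHom
    refine Group.fg_of_surjective (f := q) ?_
    exact (gradedMk_surjective 0).comp (Subgroup.topEquiv (G := G)).symm.surjective
  | succ i ih =>
    let B : GradedQuot G i →* (G →* GradedQuot G (i + 1)) :=
      QuotientGroup.lift _ (bracket G i) (fun x hx => bracket_eq_one hx)
    obtain ⟨S, hS, hSf⟩ := Group.fg_iff.1 ih
    obtain ⟨T, hT, hTf⟩ := Group.fg_iff.1 hG
    refine Group.fg_iff.2 ⟨Set.image2 (fun s t => B s t) S T, ?_, hSf.image2 _ hTf⟩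
    apply eq_top_of_bracket_mem
    set Q := Subgroup.closure (Set.image2 (fun s t => B s t) S T)
    have hB : (MonoidHom.compHom (QuotientGroup.mk' Q)).comp B = 1 := by
      refine MonoidHom.eq_of_eqOn_dense hS fun s hs => ?_
      refine MonoidHom.eq_of_eqOn_dense hT fun t ht => ?_
      exact (QuotientGroup.eq_one_iff _).2 (Subgroup.subset_closure ⟨s, hs, t, ht, rfl⟩)
    intro x y
    have := DFunLike.congr_fun (DFunLike.congr_fun hB (gradedMk G i x)) y
    exact (QuotientGroup.eq_one_iff _).1 this

theorem lie_finite [Group.FG G] (i : ℕ) : Module.Finite ℤ (Lie G i) := by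
  have := gradedQuot_fg (G := G) i
  rw [Module.Finite.iff_addGroup_fg]
  exact AddGroup.fg_iff_mul_fg.2 this

/-- A map with commutative image kills `G^2`, and index `i ≥ 1` means degree at least two. -/
theorem lieMap_eq_zero_of_commute (f : G →* H) (hf : ∀ x y, Commute (f x) (f y)) {i : ℕ}
    (hi : 1 ≤ i) : lieMap f i = 0 := by
  refine AddMonoidHom.ext fun x => ?_
  obtain ⟨x, rfl⟩ := gradedMk_surjective i x
  have : termMap f i x = 1 := Subtype.ext (term_one_le_ker f hf (term_antitone hi x.2))
  change Additive.ofMul (gradedMk H i (termMap f i x)) = 0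
  rw [this, map_one]
  rfl

/-- Conjugation changes `x` by the commutator `⁅c, x⁆`, which lies one step deeper. This is why
sections up to conjugation suffice. -/
theorem lieMap_conj (f : G →* G) (c : G) (hf : ∀ x, f x = c * x * c⁻¹) (i : ℕ) :
    lieMap f i = AddMonoidHom.id _ := by
  refine AddMonoidHom.ext fun x => ?_
  obtain ⟨x, rfl⟩ := gradedMk_surjective i x
  change Additive.ofMul (gradedMk G i (termMap f i x)) = Additive.ofMul (gradedMk G i x)
  have : gradedMk G i (termMap f i x) = gradedMk G i x := by
    rw [← mul_inv_eq_one, ← map_inv, ← map_mul, gradedMk_eq_one_iff]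
    have h : ((termMap f i x * x⁻¹ : term G i) : G) = ⁅c, (x : G)⁆ := by
      change f x * (x : G)⁻¹ = _
      rw [hf, commutatorElement_def]
    rw [h]
    exact commutator_mem_term' x.2 c
  rw [this]

theorem lieMap_comp {K : Type*} [Group K] (f : G →* H) (g : H →* K) (i : ℕ) (x : Lie G i) :
    lieMap g i (lieMap f i x) = lieMap (g.comp f) i x := by
  obtain ⟨x, rfl⟩ := gradedMk_surjective i x
  rfl

end LowerCentral

/-! ### Split surjections of abelian groups that are injective modulo all primes -/

-- Right exactness of the tensor product applied to `ℤ → ℤ → ZMod p` identifies `L ⊗ ZMod p` with `L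
-- / pL`.
open TensorProduct in
theorem exists_eq_smul_of_tmul_one_eq_zero {L : Type*} [AddCommGroup L] (p : ℕ) {x : L}
    (hx : x ⊗ₜ[ℤ] (1 : ZMod p) = 0) : ∃ y : L, x = (p : ℤ) • y := by
  let f : ℤ →ₗ[ℤ] ℤ := (p : ℤ) • LinearMap.id
  let g : ℤ →ₗ[ℤ] ZMod p := (Int.castAddHom (ZMod p)).toIntLinearMap
  have hfg : Function.Exact f g := by
    intro m
    change ((m : ℤ) : ZMod p) = 0 ↔ _
    rw [CharP.intCast_eq_zero_iff (ZMod p) p m]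
    exact ⟨fun ⟨c, hc⟩ => ⟨c, hc.symm⟩, fun ⟨c, hc⟩ => ⟨c, hc.symm⟩⟩
  have hg : Function.Surjective g := ZMod.intCast_surjective
  have hE := lTensor_exact L hfg hg
  obtain ⟨y, hy⟩ := (hE (x ⊗ₜ[ℤ] (1 : ℤ))).1 (by simpa [g] using hx)
  refine ⟨TensorProduct.rid ℤ L y, ?_⟩
  have h1 : f.lTensor L y = (p : ℤ) • y := by
    change ((p : ℤ) • LinearMap.id).lTensor L y = _
    rw [LinearMap.lTensor_smul, LinearMap.lTensor_id]
    rfl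
  have := congrArg (TensorProduct.rid ℤ L) (hy.symm.trans h1)
  simpa using this

/-- Injectivity modulo `p` makes a kernel element divisible by `p` in `L`, and the splitting moves
the quotient back into the kernel. The kernel is then divisible and finitely generated, hence zero.
-/
theorem injective_of_split_of_rTensor_zmod_injective {L P : Type*} [AddCommGroup L]
    [AddCommGroup P] [Module.Finite ℤ L] (ρ : L →ₗ[ℤ] P) (σ : P →ₗ[ℤ] L)
    (hρσ : ∀ v, ρ (σ v) = v)
    (h : ∀ p : ℕ, p.Prime → Function.Injective (ρ.rTensor (ZMod p))) :
    Function.Injective ρ := by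
  have hp : ∀ p : ℕ, p.Prime → ∀ x ∈ LinearMap.ker ρ, ∃ y ∈ LinearMap.ker ρ, x = (p : ℤ) • y := by
    intro p hp x hx
    rw [LinearMap.mem_ker] at hx
    obtain ⟨y, rfl⟩ := exists_eq_smul_of_tmul_one_eq_zero p (x := x)
      (h p hp (by simp [hx]))
    refine ⟨y - σ (ρ y), by simp [hρσ], ?_⟩
    rw [smul_sub, ← map_smul, ← map_smul, hx, map_zero, sub_zero]
  have hn : ∀ n : ℕ, n ≠ 0 → ∀ x ∈ LinearMap.ker ρ, ∃ y ∈ LinearMap.ker ρ, x = (n : ℤ) • y := by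
    intro n
    induction n using Nat.recOnMul with
    | zero => simp
    | one => exact fun _ x hx => ⟨x, hx, by simp⟩
    | prime q hq => exact fun _ => hp q hq
    | mul a b iha ihb =>
      intro hab x hx
      obtain ⟨y, hy, rfl⟩ := iha (left_ne_zero_of_mul hab) x hx
      obtain ⟨z, hz, rfl⟩ := ihb (right_ne_zero_of_mul hab) y hy
      exact ⟨z, hz, by rw [smul_smul, Nat.cast_mul]⟩
  have hK : (LinearMap.ker ρ).FG := IsNoetherian.noetherian _
  -- Nakayama's lemma for the ideal `(2)` gives an odd, hence nonzero, integer `r` that annihilates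
  -- the kernel. Divisibility by `|r|` then finishes.
  obtain ⟨r, hr, hr0⟩ := Submodule.exists_sub_one_mem_and_smul_eq_zero_of_fg_of_le_smul
    (Ideal.span {(2 : ℤ)}) (LinearMap.ker ρ) hK (by
      intro x hx
      obtain ⟨y, hy, rfl⟩ := hp 2 Nat.prime_two x hx
      exact Submodule.smul_mem_smul (Ideal.subset_span rfl) hy)
  have hrne : r.natAbs ≠ 0 := by
    rw [Ideal.mem_span_singleton] at hr
    omega
  rw [← LinearMap.ker_eq_bot, eq_bot_iff]
  intro x hx
  obtain ⟨y, hy, rfl⟩ := hn _ hrne x hx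
  rcases Int.natAbs_eq r with h' | h'
  · rw [← h', hr0 y hy]; rfl
  · rw [show (r.natAbs : ℤ) = -r by omega, neg_smul, hr0 y hy, neg_zero]; rfl

/-! ### Groups that decompose over a family of local groups -/

namespace LowerCentral

variable {G ι : Type*} [Group G]

/-- The weights are dual to the generators, so the abelianization map is the product of the powers
`(a i) ^ (w i)`; the two maps agree on generators. -/
theorem mem_term_one_of_weights [Finite ι] (a : ι → G)
    (hgen : Subgroup.closure (Set.range a) = ⊤) [DecidableEq ι]
    (w : ι → G →* Multiplicative ℤ)
    (hw : ∀ i j, w i (a j) = if i = j then Multiplicative.ofAdd 1 else 1)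
    {g : G} (hg : ∀ i, w i g = 1) : g ∈ term G 1 := by
  cases nonempty_fintype ι
  let θ : G →* Abelianization G :=
    ∏ i, (zpowersHom (Abelianization G) (Abelianization.of (a i))).comp (w i)
  have hθ : θ = Abelianization.of := by
    refine MonoidHom.eq_of_eqOn_dense hgen ?_
    rintro _ ⟨j, rfl⟩
    simp only [θ, MonoidHom.finsetProd_apply, MonoidHom.comp_apply, hw]
    rw [Finset.prod_eq_single j]
    · simp
    · intro i _ hij
      simp [hij]
    · simp
  have h1 : Abelianization.of g = 1 := by
    rw [← hθ]
    simp [θ, MonoidHom.finsetProd_apply, hg]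
  have h2 : g ∈ commutator G := by
    rw [← Abelianization.ker_of G]
    exact h1
  rwa [← Subgroup.top_lowerCentralSeries_one] at h2

/-- The bracket `G × G → G^2 / G^3`. -/
def bracketZero (G : Type*) [Group G] : G →* (G →* GradedQuot G 1) :=
  (bracket G 0).comp (Subgroup.topEquiv (G := G)).symm.toMonoidHom

/-- The bracket takes values in a commutative group, so each argument matters only modulo `G^2`. -/
theorem bracketZero_congr {x x' y y' : G} (hx : x * x'⁻¹ ∈ term G 1) (hy : y * y'⁻¹ ∈ term G 1) :
    bracketZero G x y = bracketZero G x' y' := by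
  have h1 : bracketZero G x = bracketZero G x' := by
    rw [← mul_inv_eq_one, ← map_inv, ← map_mul]
    exact term_one_le_ker (bracketZero G) (fun _ _ => Commute.all _ _) hx
  rw [h1, ← mul_inv_eq_one, ← map_inv, ← map_mul]
  exact term_one_le_ker (bracketZero G x') (fun _ _ => Commute.all _ _) hy

/-- The endomorphism of `G^{i+1} / G^{i+2}` induced by an endomorphism of `G`. -/
def gradedMap (f : G →* G) (i : ℕ) : GradedQuot G i →* GradedQuot G i :=
  AddMonoidHom.toMultiplicative (lieMap f i)

theorem gradedMap_gradedMk (f : G →* G) (i : ℕ) (x : term G i) :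
    gradedMap f i (gradedMk G i x) = gradedMk G i (termMap f i x) := rfl

theorem gradedMap_bracketZero (f : G →* G) (x y : G) :
    gradedMap f 1 (bracketZero G x y) = bracketZero G (f x) (f y) := by
  change gradedMk G 1 _ = gradedMk G 1 _
  congr 1
  exact Subtype.ext (map_commutatorElement f x y)

variable {𝒳 : Type*} {L : 𝒳 → Type*} [∀ X, Group (L X)]

/-- In degree two, an element is detected by a family of local groups such that each pair of
generators lives in exactly one of them. -/
theorem mem_term_two_of_local [Finite ι] [Fintype 𝒳] (a : ι → G)
    (hgen : Subgroup.closure (Set.range a) = ⊤) [DecidableEq ι]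
    (ρ : ∀ X, G →* L X) (s : ∀ X, L X →* G) (mem : 𝒳 → Set ι)
    (w : ι → G →* Multiplicative ℤ)
    (hw : ∀ i j, w i (a j) = if i = j then Multiplicative.ofAdd 1 else 1)
    (hρa : ∀ X i, i ∉ mem X → ρ X (a i) = 1)
    (hws : ∀ X i, i ∉ mem X → ∀ x, w i (s X x) = 1)
    (hwρ : ∀ X i, i ∈ mem X → ∃ w' : L X →* Multiplicative ℤ, ∀ g, w i g = w' (ρ X g))
    (hinner : ∀ X, ∃ c : L X, ∀ x, ρ X (s X x) = c * x * c⁻¹)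
    (hpair : ∀ i j, i ≠ j → ∃! X, i ∈ mem X ∧ j ∈ mem X)
    {u : G} (hu : u ∈ term G 1) (hρu : ∀ X, ρ X u ∈ term (L X) 2) : u ∈ term G 2 := by
  classical
  let e : ∀ X, G →* G := fun X => (s X).comp (ρ X)
  -- Weights decide. A weight `k ∈ mem X` factors through `ρ X` and cannot see the inner
  -- automorphism; a weight `k ∉ mem X` vanishes on the image of `s X` and on `a i`.
  have he : ∀ X i, i ∈ mem X → e X (a i) * (a i)⁻¹ ∈ term G 1 := by
    intro X i hi
    refine mem_term_one_of_weights a hgen w hw fun k => ?_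
    rw [map_mul, map_inv, mul_inv_eq_one]
    by_cases hk : k ∈ mem X
    · obtain ⟨w', hw'⟩ := hwρ X k hk
      obtain ⟨c, hc⟩ := hinner X
      rw [hw', hw']
      simp only [e, MonoidHom.comp_apply, hc, map_mul, map_inv]
      rw [mul_comm, inv_mul_cancel_left]
    · have hki : k ≠ i := fun h => hk (h ▸ hi)
      simp only [e, MonoidHom.comp_apply, hws X k hk, hw, if_neg hki]
  have he1 : ∀ X i, i ∉ mem X → e X (a i) = 1 := fun X i hi => by
    simp [e, hρa X i hi]
  let γ : G →* (G →* GradedQuot G 1) :=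
    ∏ X, (MonoidHom.compHom' (e X)).comp ((bracketZero G).comp (e X))
  have hγ : ∀ x y, γ x y = ∏ X, bracketZero G (e X x) (e X y) := by
    intro x y
    simp [γ, MonoidHom.finsetProd_apply]
  -- On a pair of distinct generators only the unique `X` containing both contributes, and there `e
  -- X` fixes both modulo `G^2`.
  have hγβ : bracketZero G = γ := by
    refine MonoidHom.eq_of_eqOn_dense hgen ?_
    rintro _ ⟨i, rfl⟩
    refine MonoidHom.eq_of_eqOn_dense hgen ?_
    rintro _ ⟨j, rfl⟩
    rw [hγ]
    by_cases hij : i = j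
    · subst hij
      have hself : ∀ x : G, bracketZero G x x = 1 := fun x => by
        change gradedMk G 1 _ = 1
        rw [gradedMk_eq_one_iff]
        change ⁅x, x⁆ ∈ _
        rw [commutatorElement_self]
        exact one_mem _
      simp [hself]
    · obtain ⟨X, ⟨hXi, hXj⟩, huniq⟩ := hpair i j hij
      rw [Finset.prod_eq_single X]
      · exact (bracketZero_congr (he X i hXi) (he X j hXj)).symm
      · intro Y _ hY
        by_cases hYi : i ∈ mem Y
        · have hYj : j ∉ mem Y := fun h => hY (huniq Y ⟨hYi, h⟩)
          rw [he1 Y j hYj, map_one]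
        · rw [he1 Y i hYi, map_one]
          rfl
      · simp
  let θ : GradedQuot G 1 →* GradedQuot G 1 := ∏ X, gradedMap (e X) 1
  have hθ : ∀ z, z = θ z := by
    have : (MonoidHom.id (GradedQuot G 1)).eqLocus θ = ⊤ := by
      refine eq_top_of_bracket_mem (i := 0) _ fun x y => ?_
      change bracketZero G (x : G) y = θ (bracketZero G (x : G) y)
      conv_lhs => rw [hγβ, hγ]
      simp [θ, MonoidHom.finsetProd_apply, gradedMap_bracketZero]
    intro z
    exact (this ▸ Subgroup.mem_top z : z ∈ (MonoidHom.id (GradedQuot G 1)).eqLocus θ)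
  have h1 : gradedMk G 1 ⟨u, hu⟩ = 1 := by
    rw [hθ (gradedMk G 1 ⟨u, hu⟩)]
    simp only [θ, MonoidHom.finsetProd_apply, gradedMap_gradedMk]
    refine Finset.prod_eq_one fun X _ => ?_
    rw [gradedMk_eq_one_iff]
    exact map_term_le (s X) 2 (Subgroup.mem_map_of_mem _ (hρu X))
  exact gradedMk_eq_one_iff.1 h1

/-- If the local groups split off from `G`, then a decomposition of the associated graded group
over all prime fields detects elements integrally. -/
theorem mem_term_succ_of_local [Group.FG G] [Fintype 𝒳]
    (ρ : ∀ X, G →* L X) (s : ∀ X, L X →* G)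
    (hinner : ∀ X, ∃ c : L X, ∀ x, ρ X (s X x) = c * x * c⁻¹)
    (hcomm : ∀ X Y, X ≠ Y → ∀ x y, Commute (ρ Y (s X x)) (ρ Y (s X y)))
    {i : ℕ} (hi : 1 ≤ i)
    (hdec : ∀ p : ℕ, p.Prime → Function.Injective
      ((LinearMap.pi fun X => (lieMap (ρ X) i).toIntLinearMap).rTensor (ZMod p)))
    {u : G} (hu : u ∈ term G i) (hρu : ∀ X, ρ X u ∈ term (L X) (i + 1)) :
    u ∈ term G (i + 1) := by
  classical
  have hfin := lie_finite (G := G) i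
  let R : Lie G i →ₗ[ℤ] (∀ X, Lie (L X) i) :=
    LinearMap.pi fun X => (lieMap (ρ X) i).toIntLinearMap
  let σ : (∀ X, Lie (L X) i) →ₗ[ℤ] Lie G i :=
    ∑ X, (lieMap (s X) i).toIntLinearMap ∘ₗ LinearMap.proj X
  -- The diagonal blocks are induced by inner automorphisms, hence identities; the off-diagonal
  -- blocks come from maps with commutative image and vanish in degree at least two.
  have hRσ : ∀ v, R (σ v) = v := by
    intro v
    ext1 Y
    change lieMap (ρ Y) i (σ v) = v Y
    have h1 : σ v = ∑ X, lieMap (s X) i (v X) := by simp [σ]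
    rw [h1, map_sum, Finset.sum_eq_single Y]
    · obtain ⟨c, hc⟩ := hinner Y
      rw [lieMap_comp, lieMap_conj ((ρ Y).comp (s Y)) c hc]
      rfl
    · intro X _ hXY
      rw [lieMap_comp, lieMap_eq_zero_of_commute _ (fun x y => hcomm X Y hXY x y) hi]
      rfl
    · simp
  have hinj := injective_of_split_of_rTensor_zmod_injective R σ hRσ hdec
  have h0 : Additive.ofMul (gradedMk G i ⟨u, hu⟩) = 0 := by
    apply hinj
    rw [map_zero]
    ext1 X
    change Additive.ofMul (gradedMk (L X) i (termMap (ρ X) i ⟨u, hu⟩)) = 0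
    exact congrArg Additive.ofMul (gradedMk_eq_one_iff.2 (hρu X))
  exact gradedMk_eq_one_iff.1 (congrArg Additive.toMul h0)

/-- A group with a finite generating set that decomposes over local groups: the elements that
vanish in the nonabelian local groups lie in the nilpotent residue. -/
theorem mem_nilpotentResidue_of_local [Finite ι] [Fintype 𝒳] (a : ι → G)
    (hgen : Subgroup.closure (Set.range a) = ⊤) [DecidableEq ι]
    (ρ : ∀ X, G →* L X) (s : ∀ X, L X →* G) (mem : 𝒳 → Set ι)
    (w : ι → G →* Multiplicative ℤ)
    (hw : ∀ i j, w i (a j) = if i = j then Multiplicative.ofAdd 1 else 1)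
    (hρa : ∀ X i, i ∉ mem X → ρ X (a i) = 1)
    (hws : ∀ X i, i ∉ mem X → ∀ x, w i (s X x) = 1)
    (hwρ : ∀ X i, i ∈ mem X → ∃ w' : L X →* Multiplicative ℤ, ∀ g, w i g = w' (ρ X g))
    (hinner : ∀ X, ∃ c : L X, ∀ x, ρ X (s X x) = c * x * c⁻¹)
    (hcomm : ∀ X Y, X ≠ Y → ∀ x y, Commute (ρ Y (s X x)) (ρ Y (s X y)))
    (hpair : ∀ i j, i ≠ j → ∃! X, i ∈ mem X ∧ j ∈ mem X)
    (𝒳₀ : Set 𝒳) (hab : ∀ X ∉ 𝒳₀, ∀ x y : L X, Commute x y)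
    (hcover : ∀ i, ∃ X ∈ 𝒳₀, i ∈ mem X)
    (hdec : ∀ i : ℕ, 2 ≤ i → ∀ p : ℕ, p.Prime → Function.Injective
      ((LinearMap.pi fun X => (lieMap (ρ X) i).toIntLinearMap).rTensor (ZMod p)))
    {g : G} (hg : ∀ X ∈ 𝒳₀, ρ X g = 1) : g ∈ nilpotentResidue G := by
  have : Group.FG G := Group.fg_iff.2 ⟨_, hgen, Set.finite_range a⟩
  have h1 : g ∈ term G 1 := by
    refine mem_term_one_of_weights a hgen w hw fun i => ?_
    obtain ⟨X, hX, hi⟩ := hcover i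
    obtain ⟨w', hw'⟩ := hwρ X i hi
    rw [hw', hg X hX, map_one]
  have hρ : ∀ X n, ρ X g ∈ term (L X) n := by
    intro X n
    by_cases hX : X ∈ 𝒳₀
    · rw [hg X hX]
      exact one_mem _
    -- Here the local group is abelian, so membership of `g` in `G^2` already kills `ρ X g`.
    · have : ρ X g = 1 := term_one_le_ker (ρ X) (fun _ _ => hab X hX _ _) h1
      rw [this]
      exact one_mem _
  refine Subgroup.mem_iInf.2 fun n => ?_
  induction n with
  | zero => trivial
  | succ n ih =>
    -- Index `n` is degree `n + 1`: decomposability takes over from degree three, and the two lower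
    -- degrees use weights and brackets.
    rcases Nat.lt_or_ge n 2 with hn | hn
    · interval_cases n
      · exact h1
      · exact mem_term_two_of_local a hgen ρ s mem w hw hρa hws hwρ hinner hpair h1
          fun X => hρ X 2
    · exact mem_term_succ_of_local ρ s hinner hcomm (by omega) (hdec n hn) ih
        fun X => hρ X (n + 1)

end LowerCentral

/-! ### Fundamental groups of unions of two simply connected open sets -/

open Topology unitInterval

section TwoCharts

variable {X : Type*} [TopologicalSpace X] {K : Type*} [Group K]

/-- The bundle with discrete fibre `K` over a space covered by two open sets `W false` and
`W true`, glued along a locally constant function `τ` on the intersection. -/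
noncomputable def twoChartCore [TopologicalSpace K] [DiscreteTopology K] (W : Bool → Set X)
    (hW : ∀ i, IsOpen (W i)) (hcov : ∀ x, x ∈ W false ∨ x ∈ W true) (τ : X → K)
    (hτ : ∀ x ∈ W false ∩ W true, ∀ᶠ y in 𝓝 x, τ y = τ x) :
    FiberBundleCore Bool X K where
  baseSet := W
  isOpen_baseSet := hW
  indexAt := by
    classical
    exact fun x => if x ∈ W false then false else true
  mem_baseSet_at := by
    intro x
    by_cases h : x ∈ W false
    · simp [h]
    · simpa [h] using (hcov x).resolve_left h
  -- Gluing multiplies on the right, so that left multiplication is globally defined and supplies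
  -- the deck transformations.
  coordChange i j x v := v * (cond i (τ x) 1)⁻¹ * cond j (τ x) 1
  coordChange_self := by
    intro i x _ v
    simp
  continuousOn_coordChange := by
    have hc : ContinuousOn (fun p : X × K => τ p.1) ((W false ∩ W true) ×ˢ Set.univ) := by
      have : ContinuousOn τ (W false ∩ W true) := fun x hx =>
        (tendsto_nhds_of_eventually_eq (hτ x hx)).mono_left nhdsWithin_le_nhds
      exact this.comp continuousOn_fst fun p hp => hp.1
    intro i j
    cases i <;> cases j
    · simpa using continuousOn_snd
    · have := continuousOn_snd.mul hc
      simpa [Pi.mul_def] using this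
    · rw [Set.inter_comm]
      have := continuousOn_snd.mul hc.inv
      simpa [Pi.mul_def, Pi.inv_def] using this
    · simpa using continuousOn_snd
  coordChange_comp := by
    intro i j k x _ v
    simp [mul_assoc]

variable [TopologicalSpace K] [DiscreteTopology K] (W : Bool → Set X)
    (hW : ∀ i, IsOpen (W i)) (hcov : ∀ x, x ∈ W false ∨ x ∈ W true) (τ : X → K)
    (hτ : ∀ x ∈ W false ∩ W true, ∀ᶠ y in 𝓝 x, τ y = τ x)

/-- The point of the bundle `twoChartCore` over `x` with preferred fibre coordinate `v`. -/
def twoChartPoint (x : X) (v : K) : (twoChartCore W hW hcov τ hτ).TotalSpace := ⟨x, v⟩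

/-- The preferred fibre coordinate of a point of the bundle `twoChartCore`. -/
def twoChartCoord (e : (twoChartCore W hW hcov τ hτ).TotalSpace) : K := e.2

/-- Left multiplication in the fibres of the bundle `twoChartCore`. -/
instance twoChartAction : MulAction K (twoChartCore W hW hcov τ hτ).TotalSpace where
  smul k e := twoChartPoint W hW hcov τ hτ e.1 (k * twoChartCoord W hW hcov τ hτ e)
  one_smul e := by
    change twoChartPoint W hW hcov τ hτ e.1 (1 * twoChartCoord W hW hcov τ hτ e) = e
    rw [one_mul]
    rfl
  mul_smul k l e := by
    change twoChartPoint W hW hcov τ hτ e.1 (k * l * twoChartCoord W hW hcov τ hτ e) =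
      twoChartPoint W hW hcov τ hτ e.1 (k * (l * twoChartCoord W hW hcov τ hτ e))
    rw [mul_assoc]

theorem smul_twoChartPoint (k : K) (x : X) (v : K) :
    k • twoChartPoint W hW hcov τ hτ x v = twoChartPoint W hW hcov τ hτ x (k * v) := rfl

theorem twoChartPoint_injective (x : X) {v u : K}
    (h : twoChartPoint W hW hcov τ hτ x v = twoChartPoint W hW hcov τ hτ x u) : v = u :=
  eq_of_heq (Bundle.TotalSpace.mk.inj h).2

theorem exists_twoChartPoint (e : (twoChartCore W hW hcov τ hτ).TotalSpace) :
    ∃ x v, e = twoChartPoint W hW hcov τ hτ x v :=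
  ⟨e.1, twoChartCoord W hW hcov τ hτ e, rfl⟩

/-- The discrete fibre makes the bundle a covering. Left multiplication commutes with the gluing and
is free and transitive on each fibre. -/
theorem isQuotientCoveringMap_twoChart :
    IsQuotientCoveringMap (twoChartCore W hW hcov τ hτ).proj K := by
  rw [isQuotientCoveringMap_iff_isCoveringMap_and]
  refine ⟨FiberBundle.isCoveringMap (F := K) (E := (twoChartCore W hW hcov τ hτ).Fiber),
    fun x => ⟨twoChartPoint W hW hcov τ hτ x 1, rfl⟩, ⟨fun k => ?_⟩, ?_, ?_⟩
  · rw [continuous_iff_continuousAt]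
    intro e
    rw [FiberBundle.continuousAt_totalSpace]
    refine ⟨(FiberBundle.continuous_proj K _).continuousAt, ?_⟩
    have h := ((FiberBundle.continuousAt_totalSpace K (f := id) (x₀ := e)).1 continuousAt_id).2
    have h2 := (continuous_const_mul k).continuousAt.comp h
    refine h2.congr (Filter.Eventually.of_forall fun y => ?_)
    have : ∀ v a b : K, k * (v * a * b) = k * v * a * b := fun v a b => by
      simp only [mul_assoc]
    exact this _ _ _
  · refine @IsCancelSMul.mk _ _ _ (@IsLeftCancelSMul.mk _ _ _ ?_) ?_
    · intro k d e h
      exact MulAction.injective k h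
    · intro k l e h
      obtain ⟨x, v, rfl⟩ := exists_twoChartPoint W hW hcov τ hτ e
      exact mul_right_cancel (twoChartPoint_injective W hW hcov τ hτ x h)
  · intro d e
    obtain ⟨x, v, rfl⟩ := exists_twoChartPoint W hW hcov τ hτ d
    obtain ⟨y, u, rfl⟩ := exists_twoChartPoint W hW hcov τ hτ e
    constructor
    · intro h
      have h1 : x = y := h
      subst h1
      refine ⟨v * u⁻¹, ?_⟩
      change (v * u⁻¹) • twoChartPoint W hW hcov τ hτ x u = _
      rw [smul_twoChartPoint, inv_mul_cancel_right]
    · rintro ⟨k, hk⟩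
      exact (congrArg Bundle.TotalSpace.proj hk).symm

/-- The section of the bundle `twoChartCore` over a chart with constant coordinate `v`. -/
theorem continuousOn_twoChartSection (i : Bool) (v : K) :
    ContinuousOn (fun x => twoChartPoint W hW hcov τ hτ x ((twoChartCore W hW hcov τ hτ).coordChange
      i ((twoChartCore W hW hcov τ hτ).indexAt x) x v)) (W i) := by
  have h1 := ((twoChartCore W hW hcov τ hτ).localTriv i).toOpenPartialHomeomorph.continuousOn_symm
  have h2 : ContinuousOn (fun x : X => (x, v)) (W i) := by fun_prop
  refine (h1.comp h2 fun x hx => ?_)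
  exact ((twoChartCore W hW hcov τ hτ).mem_localTriv_target i (x, v)).2 hx

theorem twoChartSection_apply (i : Bool) (v : K) {x : X} (hx : x ∈ W false) :
    twoChartPoint W hW hcov τ hτ x ((twoChartCore W hW hcov τ hτ).coordChange
      i ((twoChartCore W hW hcov τ hτ).indexAt x) x v) =
    twoChartPoint W hW hcov τ hτ x (v * (cond i (τ x) 1)⁻¹) := by
  have : (twoChartCore W hW hcov τ hτ).indexAt x = false := by simp [twoChartCore, hx]
  rw [this]
  exact congrArg (twoChartPoint W hW hcov τ hτ x) (mul_one _)

end TwoCharts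

/-- Monodromy of the principal `K`-bundle glued along `τ`. A loop that leaves through one chart and
returns through the other has constant coordinates on each half, so it only sees the transition at
the crossing point `q`. -/
theorem exists_hom_of_two_charts {X : Type*} [TopologicalSpace X] {K : Type*} [Group K]
    (W : Bool → Set X)
    (hW : ∀ i, IsOpen (W i)) (hcov : ∀ x, x ∈ W false ∨ x ∈ W true) (τ : X → K)
    (hτ : ∀ x ∈ W false ∩ W true, ∀ᶠ y in 𝓝 x, τ y = τ x)
    {x₀ : X} (hx₀ : x₀ ∈ W false) (hτ₀ : τ x₀ = 1) :
    ∃ φ : FundamentalGroup X x₀ →* K, ∀ (q : X) (α : Path x₀ q) (β : Path q x₀),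
      (∀ t, α t ∈ W true) → (∀ t, β t ∈ W false) →
      φ (FundamentalGroup.fromPath (.mk (α.trans β))) = τ q := by
  let _ : TopologicalSpace K := ⊥
  have : DiscreteTopology K := ⟨rfl⟩
  have hp := isQuotientCoveringMap_twoChart W hW hcov τ hτ
  let pt := twoChartPoint W hW hcov τ hτ
  let e : (twoChartCore W hW hcov τ hτ).proj ⁻¹' {x₀} := ⟨pt x₀ 1, rfl⟩
  -- Monodromy lands in the opposite group with value `(τ q)⁻¹`; inversion corrects both at once.
  refine ⟨(MulEquiv.inv' K).symm.toMonoidHom.comp (hp.fundamentalGroupToMulOpposite e), ?_⟩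
  intro q α β hα hβ
  have hq : q ∈ W false := by simpa using hβ 0
  let A : Path (pt x₀ 1) (pt q (τ q)⁻¹) :=
    { toFun := fun t => _
      continuous_toFun := (continuousOn_twoChartSection W hW hcov τ hτ true 1).comp_continuous
        α.continuous hα
      source' := by
        rw [Function.comp_apply, α.source, twoChartSection_apply _ _ _ _ _ _ _ hx₀]
        simp [hτ₀, pt]
      target' := by
        rw [Function.comp_apply, α.target, twoChartSection_apply _ _ _ _ _ _ _ hq]
        simp [pt] }
  let B : Path (pt q (τ q)⁻¹) (pt x₀ (τ q)⁻¹) :=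
    { toFun := fun t => _
      continuous_toFun := (continuousOn_twoChartSection W hW hcov τ hτ false
        (τ q)⁻¹).comp_continuous β.continuous hβ
      source' := by
        rw [Function.comp_apply, β.source, twoChartSection_apply _ _ _ _ _ _ _ hq]
        simp [pt]
      target' := by
        rw [Function.comp_apply, β.target, twoChartSection_apply _ _ _ _ _ _ _ hx₀]
        simp [pt] }
  let e' : (twoChartCore W hW hcov τ hτ).proj ⁻¹' {x₀} := ⟨pt x₀ (τ q)⁻¹, rfl⟩
  have hmon : hp.isCoveringMap.monodromy (.mk (α.trans β)) e = e' := by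
    refine hp.isCoveringMap.monodromy_eq_of_map_eq (.mk (A.trans B)) ?_
    change Path.Homotopic.Quotient.mk ((A.trans B).map hp.isCoveringMap.continuous) =
      Path.Homotopic.Quotient.mk (α.trans β)
    rw [Path.map_trans]
    rfl
  have hφ : hp.fundamentalGroupToMulOpposite e (FundamentalGroup.fromPath (.mk (α.trans β))) =
      MulOpposite.op (τ q)⁻¹ := by
    rw [hp.fundamentalGroupToMulOpposite_apply_eq_Iff]
    refine Eq.trans ?_ (congrArg Subtype.val hmon).symm
    exact congrArg (pt x₀) (mul_one ((τ q)⁻¹ : K))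
  change (MulEquiv.inv' K).symm (hp.fundamentalGroupToMulOpposite e _) = _
  rw [hφ]
  simp [MulEquiv.inv']

/-! ### Generating the fundamental group by loops that cross between two charts. -/

section Generation

variable {X : Type*} [TopologicalSpace X]

theorem IsSimplyConnected.homotopic {s : Set X} (hs : IsSimplyConnected s) {x y : X}
    (p q : Path x y) (hp : ∀ t, p t ∈ s) (hq : ∀ t, q t ∈ s) : p.Homotopic q := by
  have := hs.simplyConnectedSpace
  let lift : ∀ r : Path x y, (∀ t, r t ∈ s) →
      Path (⟨x, by simpa using hp 0⟩ : s) ⟨y, by simpa using hp 1⟩ := fun r hr =>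
    { toFun := fun t => ⟨r t, hr t⟩
      continuous_toFun := r.continuous.subtype_mk hr
      source' := Subtype.ext r.source
      target' := Subtype.ext r.target }
  exact (SimplyConnectedSpace.paths_homotopic (lift p hp) (lift q hq)).map
    (⟨Subtype.val, continuous_subtype_val⟩ : C(s, X))

theorem IsSimplyConnected.exists_path {s : Set X} (hs : IsSimplyConnected s) {x y : X}
    (hx : x ∈ s) (hy : y ∈ s) : ∃ p : Path x y, ∀ t, p t ∈ s :=
  ⟨(hs.isPathConnected.joinedIn x hx y hy).somePath,
    (hs.isPathConnected.joinedIn x hx y hy).somePath_mem⟩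

/-- The loops that go out in `W true` and come back in `W false`. -/
def crossingLoops (W : Bool → Set X) (x₀ : X) : Set (FundamentalGroup X x₀) :=
  {g | ∃ (q : X) (α : Path x₀ q) (β : Path q x₀), (∀ t, α t ∈ W true) ∧ (∀ t, β t ∈ W false) ∧
    g = FundamentalGroup.fromPath (.mk (α.trans β))}

theorem Path.trans_mem {x y z : X} {s : Set X} {p : Path x y} {q : Path y z}
    (hp : ∀ t, p t ∈ s) (hq : ∀ t, q t ∈ s) (t : I) : p.trans q t ∈ s := by
  have h : p.trans q t ∈ Set.range (p.trans q) := ⟨t, rfl⟩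
  rw [Path.trans_range] at h
  rcases h with ⟨u, hu⟩ | ⟨u, hu⟩
  · exact hu ▸ hp u
  · exact hu ▸ hq u

/-- This measures the effect of changing the return path to the base point. It is trivial within one
simply connected chart; between two charts the change is a crossing loop or the inverse of one. -/
theorem mem_closure_crossingLoops {W : Bool → Set X}
    (hsc : ∀ i, IsSimplyConnected (W i)) {x₀ q : X} (i j : Bool) (δ : Path q x₀) (ε : Path q x₀)
    (hδ : ∀ t, δ t ∈ W i) (hε : ∀ t, ε t ∈ W j) :
    FundamentalGroup.fromPath (.mk (δ.symm.trans ε)) ∈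
      Subgroup.closure (crossingLoops W x₀) := by
  have hself : ∀ i (δ ε : Path q x₀), (∀ t, δ t ∈ W i) → (∀ t, ε t ∈ W i) →
      FundamentalGroup.fromPath (.mk (δ.symm.trans ε)) ∈
      Subgroup.closure (crossingLoops W x₀) := by
    intro i δ ε hδ hε
    have : FundamentalGroup.fromPath (.mk (δ.symm.trans ε)) = (1 : FundamentalGroup X x₀) := by
      rw [FundamentalGroup.one_def, ← Path.Homotopic.Quotient.mk_refl]
      refine Path.Homotopic.Quotient.eq.2 ((hsc i).homotopic _ _ ?_ ?_)
      · exact Path.trans_mem (fun t => hδ _) hε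
      · intro t
        simpa using hδ 1
    rw [this]
    exact one_mem _
  cases i <;> cases j
  · exact hself _ δ ε hδ hε
  · rw [← inv_mem_iff]
    refine Subgroup.subset_closure ⟨q, ε.symm, δ, fun t => hε _, hδ, ?_⟩
    change (Path.Homotopic.Quotient.mk _).symm = Path.Homotopic.Quotient.mk _
    rw [← Path.Homotopic.Quotient.mk_symm, Path.trans_symm, Path.symm_symm]
  · exact Subgroup.subset_closure ⟨q, δ.symm, ε, fun t => hδ _, hε, rfl⟩
  · exact hself _ δ ε hδ hε

theorem Path.Homotopic.cast_trans_refl_cast {x y y' : X} (h : y' = y) (γ : Path x y) :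
    Path.Homotopic ((γ.cast rfl h).trans ((Path.refl y).cast h rfl)) γ := by
  subst h
  exact Path.Homotopic.trans_refl γ

/-- Cut a loop into pieces, each inside one chart, and close every initial segment by a return path
in some chart. Consecutive closures differ by a change of return path, and the last closure is the
loop itself. -/
theorem closure_crossingLoops (W : Bool → Set X) (hW : ∀ i, IsOpen (W i))
    (hcov : ∀ x, x ∈ W false ∨ x ∈ W true) (hsc : ∀ i, IsSimplyConnected (W i)) {x₀ : X}
    (hx₀ : ∀ i, x₀ ∈ W i) : Subgroup.closure (crossingLoops W x₀) = ⊤ := by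
  rw [eq_top_iff]
  intro g _
  obtain ⟨γ, rfl⟩ := Path.Homotopic.Quotient.mk_surjective g
  obtain ⟨t, ht0, htm, ⟨n, hn⟩, ht⟩ := exists_monotone_Icc_subset_open_cover_unitInterval
    (c := fun i => γ ⁻¹' W i) (fun i => (hW i).preimage γ.continuous) (by
      intro s _
      rcases hcov (γ s) with h | h
      · exact Set.mem_iUnion.2 ⟨false, h⟩
      · exact Set.mem_iUnion.2 ⟨true, h⟩)
  have key : ∀ n, ∀ i, ∀ δ : Path (γ (t n)) x₀, (∀ s, δ s ∈ W i) →
      FundamentalGroup.fromPath (.mk (((γ.subpath 0 (t n)).cast γ.source.symm rfl).trans δ)) ∈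
        Subgroup.closure (crossingLoops W x₀) := by
    intro n
    induction n with
    | zero =>
      intro i δ hδ
      have : FundamentalGroup.fromPath
          (.mk (((γ.subpath 0 (t 0)).cast γ.source.symm rfl).trans δ)) =
          (1 : FundamentalGroup X x₀) := by
        rw [FundamentalGroup.one_def, ← Path.Homotopic.Quotient.mk_refl]
        refine Path.Homotopic.Quotient.eq.2 ((hsc i).homotopic _ _ ?_ fun s => by simpa using hx₀ i)
        refine Path.trans_mem (fun s => ?_) hδ
        have h : (γ.subpath 0 (t 0)) s ∈ Set.range (γ.subpath 0 (t 0)) := ⟨s, rfl⟩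
        rw [Path.range_subpath] at h
        obtain ⟨r, hr, hrs⟩ := h
        have hr0 : r = 0 := by simpa [ht0] using hr
        change (γ.subpath 0 (t 0)) s ∈ _
        rw [← hrs, hr0, γ.source]
        exact hx₀ i
      rw [this]
      exact one_mem _
    | succ n ih =>
      intro j δ hδ
      obtain ⟨i, hi⟩ := ht n
      have hle : t n ≤ t (n + 1) := htm (Nat.le_succ n)
      obtain ⟨ε, hε⟩ := (hsc i).exists_path (hi ⟨hle, le_rfl⟩ : γ (t (n + 1)) ∈ W i) (hx₀ i)
      have hσ : ∀ s, γ.subpath (t n) (t (n + 1)) s ∈ W i := by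
        intro s
        have h : γ.subpath (t n) (t (n + 1)) s ∈ Set.range (γ.subpath (t n) (t (n + 1))) :=
          ⟨s, rfl⟩
        rw [Path.range_subpath_of_le _ _ _ hle] at h
        obtain ⟨r, hr, hrs⟩ := h
        exact hrs ▸ hi hr
      -- The next piece stays in `W i`, so it can be absorbed into the return path; the remaining
      -- factor replaces `ε` by `δ`. Products in `FundamentalGroup` reverse concatenation.
      have h1 := ih i ((γ.subpath (t n) (t (n + 1))).trans ε) (Path.trans_mem hσ hε)
      have h2 := mem_closure_crossingLoops hsc i j ε δ hε hδ
      have h3 := mul_mem h2 h1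
      convert h3 using 1
      rw [FundamentalGroup.mul_def]
      change Path.Homotopic.Quotient.mk _ = (Path.Homotopic.Quotient.mk _).trans (.mk _)
      have hsub : Path.Homotopic ((γ.subpath 0 (t (n + 1))).cast γ.source.symm rfl)
          (((γ.subpath 0 (t n)).cast γ.source.symm rfl).trans (γ.subpath (t n) (t (n + 1)))) :=
        Path.Homotopic.pathCast
          ⟨(Path.Homotopy.subpathTransSubpath γ 0 (t n) (t (n + 1))).symm⟩ γ.source.symm rfl
      have hsub' := Path.Homotopic.Quotient.eq.2 hsub
      simp only [Path.Homotopic.Quotient.mk_trans, Path.Homotopic.Quotient.mk_symm] at hsub' ⊢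
      rw [hsub']
      simp only [Path.Homotopic.Quotient.trans_assoc]
      congr 2
      rw [← Path.Homotopic.Quotient.trans_assoc, Path.Homotopic.Quotient.trans_symm,
        Path.Homotopic.Quotient.refl_trans]
  have hfin : ∀ s : I, s = 1 → (∀ i, ∀ δ : Path (γ s) x₀, (∀ r, δ r ∈ W i) →
      FundamentalGroup.fromPath (.mk (((γ.subpath 0 s).cast γ.source.symm rfl).trans δ)) ∈
        Subgroup.closure (crossingLoops W x₀)) →
      FundamentalGroup.fromPath (.mk γ) ∈ Subgroup.closure (crossingLoops W x₀) := by
    rintro s rfl h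
    have h1 := h false ((Path.refl x₀).cast γ.target rfl) (fun r => hx₀ false)
    convert h1 using 1
    refine Path.Homotopic.Quotient.eq.2 ?_
    have h2 : (γ.subpath 0 1).cast γ.source.symm rfl = γ.cast rfl γ.target := by
      ext r
      simp [Path.subpath_zero_one]
    rw [h2]
    exact (Path.Homotopic.cast_trans_refl_cast γ.target γ).symm
  exact hfin (t n) (hn n le_rfl) (key n)

end Generation

/-- The fundamental group of a space covered by two simply connected open sets, whose intersection
is partitioned into path connected pieces by a locally constant function, is residually
nilpotent. -/
theorem nilpotentResidue_fundamentalGroup_eq_bot {X ι : Type*} [TopologicalSpace X]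
    (W : Bool → Set X) (hW : ∀ i, IsOpen (W i))
    (hcov : ∀ x, x ∈ W false ∨ x ∈ W true) (hsc : ∀ i, IsSimplyConnected (W i))
    (κ : X → ι) (hκ : ∀ x ∈ W false ∩ W true, ∀ᶠ y in 𝓝 x, κ y = κ x)
    (hjoin : ∀ x ∈ W false ∩ W true, ∀ y ∈ W false ∩ W true, κ x = κ y →
      JoinedIn (W false ∩ W true) x y)
    {x₀ : X} (hx₀ : x₀ ∈ W false ∩ W true) :
    LowerCentral.nilpotentResidue (FundamentalGroup X x₀) = ⊥ := by
  classical
  have hx₀' : ∀ i, x₀ ∈ W i := by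
    intro i
    cases i
    exacts [hx₀.1, hx₀.2]
  -- The free basis has one crossing loop for each piece of the intersection except the piece of
  -- `x₀`, whose loops are trivial.
  let J := {c : ι // c ≠ κ x₀ ∧ ∃ q ∈ W false ∩ W true, κ q = c}
  choose q hq hκq using fun c : J => c.2.2
  choose α hα using fun c : J => (hsc true).exists_path hx₀.2 (hq c).2
  choose β hβ using fun c : J => (hsc false).exists_path (hq c).1 hx₀.1
  refine nilpotentResidue_eq_bot_of_free
    (fun c : J => FundamentalGroup.fromPath (.mk ((α c).trans (β c)))) ?_ ?_
  · rw [eq_top_iff, ← closure_crossingLoops W hW hcov hsc hx₀', Subgroup.closure_le]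
    rintro _ ⟨r, a, b, ha, hb, rfl⟩
    have hr : r ∈ W false ∩ W true := ⟨by simpa using hb 0, by simpa using ha 1⟩
    have key : ∀ (s : X) (a' : Path x₀ s) (b' : Path s x₀), (∀ t, a' t ∈ W true) →
        (∀ t, b' t ∈ W false) → JoinedIn (W false ∩ W true) s r →
        Path.Homotopic.Quotient.mk (a.trans b) = .mk (a'.trans b') := by
      intro s a' b' ha' hb' hj
      have e1 : Path.Homotopic.Quotient.mk a = .mk (a'.trans hj.somePath) :=
        Path.Homotopic.Quotient.eq.2 ((hsc true).homotopic _ _ ha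
          (Path.trans_mem ha' fun t => (hj.somePath_mem t).2))
      have e2 : Path.Homotopic.Quotient.mk b = .mk (hj.somePath.symm.trans b') :=
        Path.Homotopic.Quotient.eq.2 ((hsc false).homotopic _ _ hb
          (Path.trans_mem (fun t => (hj.somePath_mem _).1) hb'))
      rw [Path.Homotopic.Quotient.mk_trans, e1, e2]
      simp only [Path.Homotopic.Quotient.mk_trans, Path.Homotopic.Quotient.mk_symm,
        Path.Homotopic.Quotient.trans_assoc]
      congr 1
      rw [← Path.Homotopic.Quotient.trans_assoc, Path.Homotopic.Quotient.trans_symm,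
        Path.Homotopic.Quotient.refl_trans]
    by_cases h : κ r = κ x₀
    · have h1 := key x₀ (Path.refl x₀) (Path.refl x₀) (fun _ => hx₀.2) (fun _ => hx₀.1)
        (hjoin x₀ hx₀ r hr h.symm)
      have h2 : FundamentalGroup.fromPath (.mk (a.trans b)) = (1 : FundamentalGroup X x₀) := by
        rw [FundamentalGroup.one_def, h1]
        simp [Path.Homotopic.Quotient.mk_refl]
      rw [h2]
      exact one_mem _
    · let c : J := ⟨κ r, h, r, hr, rfl⟩
      refine Subgroup.subset_closure ⟨c, ?_⟩
      exact (key (q c) (α c) (β c) (hα c) (hβ c) (hjoin _ (hq c) r hr (hκq c))).symm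
  · intro K _ u
    -- Using the prescribed images as transition constants realizes any assignment on the basis; the
    -- value `1` on the piece of `x₀` is what the gluing construction needs.
    let τ' : ι → K := fun c =>
      if h : c ≠ κ x₀ ∧ ∃ q ∈ W false ∩ W true, κ q = c then u ⟨c, h⟩ else 1
    obtain ⟨φ, hφ⟩ := exists_hom_of_two_charts W hW hcov (fun x => τ' (κ x))
      (fun x hx => (hκ x hx).mono fun y hy => congrArg τ' hy) hx₀.1 (by simp [τ'])
    refine ⟨φ, fun c => ?_⟩
    rw [hφ (q c) (α c) (β c) (hα c) (hβ c), hκq c]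
    simp only [τ', dif_pos c.2]
    rfl

/-! ### Homotopies and fundamental groups -/

section Homotopy

/-- Two maps into a subset of a normed space are homotopic if the segments between their values
stay in the subset. -/
def ContinuousMap.homotopyOfSegment {Y E : Type*} [TopologicalSpace Y] [NormedAddCommGroup E]
    [NormedSpace ℝ E] {S : Set E} (f g : C(Y, S))
    (h : ∀ y, ∀ t : ℝ, 0 ≤ t → t ≤ 1 → (f y : E) + t • ((g y : E) - f y) ∈ S) :
    f.Homotopy g where
  toFun p := ⟨(f p.2 : E) + (p.1 : ℝ) • ((g p.2 : E) - f p.2), h p.2 p.1 p.1.2.1 p.1.2.2⟩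
  continuous_toFun := by fun_prop
  map_zero_left y := by simp
  map_one_left y := by simp

variable {X Y : Type*} [TopologicalSpace X] [TopologicalSpace Y]

theorem FundamentalGroup.map_trans_evalAt {f g : C(X, Y)} (F : f.Homotopy g) {x : X}
    (p : FundamentalGroup X x) :
    Path.Homotopic.Quotient.trans (FundamentalGroup.map f x p) (.mk (F.evalAt x)) =
      Path.Homotopic.Quotient.trans (.mk (F.evalAt x)) (FundamentalGroup.map g x p) := by
  obtain ⟨p, rfl⟩ := Path.Homotopic.Quotient.mk_surjective p
  exact Path.Homotopic.Quotient.eq.2 (Path.Homotopic.map_trans_evalAt F p)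

/-- The homotopy from `g ∘ f` to the identity recovers a class from its image by transport along the
track of the base point. -/
theorem FundamentalGroup.map_injective_of_homotopy {f : C(X, Y)} {g : C(Y, X)}
    (F : (g.comp f).Homotopy (ContinuousMap.id X)) (x : X) :
    Function.Injective (FundamentalGroup.map f x) := by
  intro p q hpq
  have hcomp : ∀ r : FundamentalGroup X x, FundamentalGroup.map (g.comp f) x r =
      FundamentalGroup.map g (f x) (FundamentalGroup.map f x r) := by
    intro r
    obtain ⟨r, rfl⟩ := Path.Homotopic.Quotient.mk_surjective r
    rfl
  have hid : ∀ r : FundamentalGroup X x, FundamentalGroup.map (ContinuousMap.id X) x r = r := by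
    intro r
    obtain ⟨r, rfl⟩ := Path.Homotopic.Quotient.mk_surjective r
    rfl
  have hp := FundamentalGroup.map_trans_evalAt F p
  have hq := FundamentalGroup.map_trans_evalAt F q
  rw [hcomp, hpq, ← hcomp, hq] at hp
  have h := congrArg (fun z => Path.Homotopic.Quotient.trans
    (Path.Homotopic.Quotient.symm (.mk (F.evalAt x))) z) hp
  simp only [← Path.Homotopic.Quotient.trans_assoc, Path.Homotopic.Quotient.symm_trans,
    Path.Homotopic.Quotient.refl_trans] at h
  have h' : FundamentalGroup.map (ContinuousMap.id X) x q =
    FundamentalGroup.map (ContinuousMap.id X) x p := h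
  exact ((hid q).symm.trans (h'.trans (hid p))).symm

end Homotopy

namespace LowerCentral

theorem map_mem_nilpotentResidue {G H : Type*} [Group G] [Group H] (f : G →* H) {g : G}
    (hg : g ∈ nilpotentResidue G) : f g ∈ nilpotentResidue H :=
  Subgroup.mem_iInf.2 fun i =>
    map_term_le f i (Subgroup.mem_map_of_mem f (Subgroup.mem_iInf.1 hg i))

theorem nilpotentResidue_eq_bot_of_injective {G H : Type*} [Group G] [Group H] (f : G →* H)
    (hf : Function.Injective f) (hH : nilpotentResidue H = ⊥) : nilpotentResidue G = ⊥ := by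
  rw [eq_bot_iff]
  intro g hg
  have := map_mem_nilpotentResidue f hg
  rw [hH, Subgroup.mem_bot, map_eq_one_iff f hf] at this
  exact this

end LowerCentral

/-! ### The punctured plane -/

section PuncturedPlane

/-- The sign attached to a side of the real axis. -/
def sideSign (b : Bool) : ℝ := cond b (-1) 1

theorem sideSign_mul_self (b : Bool) : sideSign b * sideSign b = 1 := by
  cases b <;> simp [sideSign]

/-- The plane with vertical rays removed that start at the points of `P`; the rays point upwards
for `b = false` and downwards for `b = true`. -/
def raySlitPlane (P : Set ℂ) (b : Bool) : Set ℂ :=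
  {z | ∀ p ∈ P, z.re = p.re → sideSign b * z.im < sideSign b * p.im}

theorem isOpen_raySlitPlane {P : Set ℂ} (hP : P.Finite) (b : Bool) : IsOpen (raySlitPlane P b) := by
  have : raySlitPlane P b =
      ⋂ p ∈ P, ({z | z.re ≠ p.re} ∪ {z | sideSign b * z.im < sideSign b * p.im}) := by
    ext z
    simp [raySlitPlane, imp_iff_not_or]
  rw [this]
  refine hP.isOpen_biInter fun p _ => ?_
  exact (isOpen_ne_fun Complex.continuous_re continuous_const).union
    (isOpen_lt (by fun_prop) continuous_const)

/-- Points slide vertically, away from the removed rays, into a half-plane beyond all of `P`; that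
half-plane is convex. -/
theorem isSimplyConnected_raySlitPlane {P : Set ℂ} (hP : P.Finite) (b : Bool) :
    IsSimplyConnected (raySlitPlane P b) := by
  obtain ⟨m, hm⟩ := (hP.image fun p => sideSign b * p.im).bddBelow
  have hm' : ∀ p ∈ P, m ≤ sideSign b * p.im := fun p hp => hm ⟨p, hp, rfl⟩
  have hlow : ∀ z : ℂ, sideSign b * z.im < m → z ∈ raySlitPlane P b :=
    fun z hz p hp _ => hz.trans_le (hm' p hp)
  have hb := sideSign_mul_self b
  let c : C(raySlitPlane P b, raySlitPlane P b) :=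
    { toFun := fun z => ⟨⟨(z : ℂ).re, sideSign b * min (sideSign b * (z : ℂ).im) (m - 1)⟩, by
        refine hlow _ ?_
        change sideSign b * (sideSign b * _) < m
        rw [← mul_assoc, hb, one_mul]
        exact (min_le_right _ _).trans_lt (by linarith)⟩
      continuous_toFun := by
        refine Continuous.subtype_mk ?_ _
        have : Continuous fun z : raySlitPlane P b =>
            (((z : ℂ).re : ℂ) + (sideSign b * min (sideSign b * (z : ℂ).im) (m - 1) : ℝ) *
              Complex.I) := by fun_prop
        convert this using 2 with z
        exact Complex.mk_eq_add_mul_I _ _ }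
  let q : raySlitPlane P b := ⟨⟨0, sideSign b * (m - 1)⟩, by
    refine hlow _ ?_
    change sideSign b * (sideSign b * _) < m
    rw [← mul_assoc, hb, one_mul]
    linarith⟩
  have H1 : (ContinuousMap.id (raySlitPlane P b)).Homotopy c := by
    refine ContinuousMap.homotopyOfSegment _ _ fun z t ht0 ht1 => ?_
    intro p hp hre
    have h1 := z.2 p hp
    simp only [ContinuousMap.id_apply, Complex.add_re, Complex.add_im, Complex.real_smul,
      Complex.mul_re, Complex.mul_im, Complex.ofReal_re, Complex.ofReal_im, Complex.sub_re,
      Complex.sub_im] at hre ⊢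
    have hcre : (c z : ℂ).re = (z : ℂ).re := rfl
    have hcim : (c z : ℂ).im = sideSign b * min (sideSign b * (z : ℂ).im) (m - 1) := rfl
    rw [hcre] at hre
    have h2 := h1 (by linarith)
    refine lt_of_le_of_lt ?_ h2
    have h3 : sideSign b * (c z : ℂ).im ≤ sideSign b * (z : ℂ).im := by
      rw [hcim, ← mul_assoc, hb, one_mul]
      exact min_le_left _ _
    nlinarith
  have H2 : c.Homotopy (ContinuousMap.const _ q) := by
    refine ContinuousMap.homotopyOfSegment _ _ fun z t ht0 ht1 => ?_
    refine hlow _ ?_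
    have hcim : sideSign b * (c z : ℂ).im ≤ m - 1 := by
      change sideSign b * (sideSign b * _) ≤ m - 1
      rw [← mul_assoc, hb, one_mul]
      exact min_le_right _ _
    have hqim : sideSign b * (q : ℂ).im = m - 1 := by
      change sideSign b * (sideSign b * _) = m - 1
      rw [← mul_assoc, hb, one_mul]
    simp only [ContinuousMap.const_apply, Complex.add_im, Complex.real_smul,
      Complex.mul_im, Complex.ofReal_re, Complex.ofReal_im,
      Complex.sub_im]
    nlinarith
  have : ContractibleSpace (raySlitPlane P b) :=
    (contractible_iff_id_nullhomotopic _).2 ⟨q, ⟨H1.trans H2⟩⟩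
  exact SimplyConnectedSpace.ofContractible _

/-- With distinct real parts, the two slit planes cover `Pᶜ`. They meet in open vertical strips,
each determined by the set of punctures to its left. Including `x₀` in the injectivity puts it
inside a strip. -/
theorem nilpotentResidue_punctured_of_injOn_re {P : Set ℂ} (hP : P.Finite)
    (x₀ : (Pᶜ : Set ℂ)) (hinj : Set.InjOn Complex.re (insert (x₀ : ℂ) P)) :
    LowerCentral.nilpotentResidue (FundamentalGroup (Pᶜ : Set ℂ) x₀) = ⊥ := by
  have himg : ∀ b, Subtype.val '' (Subtype.val ⁻¹' raySlitPlane P b : Set (Pᶜ : Set ℂ)) =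
      raySlitPlane P b := by
    intro b
    rw [Subtype.image_preimage_coe, Set.inter_eq_right]
    intro z hz hzP
    exact lt_irrefl _ (hz z hzP rfl)
  have hinter : ∀ z : ℂ, z ∈ raySlitPlane P false ∩ raySlitPlane P true ↔ ∀ p ∈ P, z.re ≠ p.re := by
    intro z
    constructor
    · rintro ⟨h1, h2⟩ p hp hre
      have h3 := h1 p hp hre
      have h4 := h2 p hp hre
      simp only [sideSign, cond_false, cond_true] at h3 h4
      linarith
    · intro h
      exact ⟨fun p hp hre => absurd hre (h p hp), fun p hp hre => absurd hre (h p hp)⟩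
  have hx₀ : ∀ p ∈ P, (x₀ : ℂ).re ≠ p.re := by
    intro p hp h
    have := hinj (Set.mem_insert _ _) (Set.mem_insert_of_mem _ hp) h
    exact x₀.2 (this ▸ hp)
  have hinterX : ∀ z : (Pᶜ : Set ℂ), z ∈ (Subtype.val ⁻¹' raySlitPlane P false ∩
      Subtype.val ⁻¹' raySlitPlane P true : Set (Pᶜ : Set ℂ)) ↔ ∀ p ∈ P, (z : ℂ).re ≠ p.re :=
    fun z => hinter z
  refine nilpotentResidue_fundamentalGroup_eq_bot
    (fun b => (Subtype.val ⁻¹' raySlitPlane P b : Set (Pᶜ : Set ℂ)))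
    (fun b => (isOpen_raySlitPlane hP b).preimage continuous_subtype_val) ?_ ?_
    (fun z => {p | p ∈ P ∧ p.re < (z : ℂ).re}) ?_ ?_ ((hinterX x₀).2 hx₀)
  · intro z
    by_contra! h
    obtain ⟨h1, h2⟩ := h
    simp only [Set.mem_preimage, raySlitPlane, Set.mem_ofPred_eq, not_forall, sideSign, cond_false,
      cond_true] at h1 h2
    obtain ⟨p, hp, hpre, hpim⟩ := h1
    obtain ⟨r, hr, hrre, hrim⟩ := h2
    have hpr : p = r := hinj (Set.mem_insert_of_mem _ hp) (Set.mem_insert_of_mem _ hr)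
      (hpre.symm.trans hrre)
    subst hpr
    exact z.2 ((Complex.ext hpre (by linarith) : (z : ℂ) = p) ▸ hp)
  · intro b
    rw [← Topology.IsEmbedding.subtypeVal.isSimplyConnected_image, himg]
    exact isSimplyConnected_raySlitPlane hP b
  · intro z hz
    rw [hinterX] at hz
    have : ∀ᶠ y : (Pᶜ : Set ℂ) in 𝓝 z, ∀ p ∈ P, (p.re < (y : ℂ).re ↔ p.re < (z : ℂ).re) := by
      rw [Filter.eventually_all_finite hP]
      intro p hp
      have hc : Continuous fun y : (Pᶜ : Set ℂ) => (y : ℂ).re := by fun_prop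
      rcases lt_or_gt_of_ne (hz p hp) with h | h
      · filter_upwards [hc.continuousAt.eventually_lt continuousAt_const h] with y hy
        exact ⟨fun h' => absurd hy h'.asymm, fun h' => absurd h h'.asymm⟩
      · filter_upwards [continuousAt_const.eventually_lt hc.continuousAt h] with y hy
        exact ⟨fun _ => h, fun _ => hy⟩
    filter_upwards [this] with y hy
    ext p
    exact and_congr_right fun hp => hy p hp
  · intro x hx y hy hxy
    rw [← Topology.IsInducing.subtypeVal.joinedIn_image hx hy]
    refine JoinedIn.of_segment_subset ?_
    intro w hw
    rw [hinterX] at hx hy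
    have hw' : ∀ p ∈ P, w.re ≠ p.re := by
      intro p hp
      have h1 : (p.re < (x : ℂ).re) ↔ (p.re < (y : ℂ).re) := by
        have h := Set.ext_iff.1 hxy p
        simpa [hp] using h
      have h2 := hx p hp
      have h3 := hy p hp
      obtain ⟨a, c, ha, hc, hac, rfl⟩ := hw
      simp only [Complex.add_re, Complex.real_smul, Complex.mul_re, Complex.ofReal_re,
        Complex.ofReal_im, zero_mul, sub_zero]
      rcases lt_or_gt_of_ne h2 with h | h
      · have h4 : (y : ℂ).re < p.re := lt_of_le_of_ne (not_lt.1 fun h5 => h.asymm (h1.2 h5)) h3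
        exact (convex_Iio p.re h h4 ha hc hac).ne
      · have h4 := h1.1 h
        exact (convex_Ioi p.re h h4 ha hc hac).ne'
    have hwP : w ∈ Pᶜ := fun hwP => hw' w hwP rfl
    exact ⟨⟨w, hwP⟩, (hinterX ⟨w, hwP⟩).2 hw', rfl⟩

/-- Multiplying by `1 + r i` merges the real parts of distinct `z` and `w` only if `r` is the ratio
of the real to the imaginary part of `z - w`, which excludes finitely many `r`. -/
theorem exists_ne_zero_injOn_re_mul {T : Set ℂ} (hT : T.Finite) :
    ∃ l : ℂ, l ≠ 0 ∧ Set.InjOn (fun z => (l * z).re) T := by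
  have hbad : ((fun p : ℂ × ℂ => (p.1 - p.2).re / (p.1 - p.2).im) '' (T ×ˢ T)).Finite :=
    (hT.prod hT).image _
  obtain ⟨r, hr⟩ := hbad.exists_notMem
  refine ⟨⟨1, r⟩, fun h => by simpa using congrArg Complex.re h, ?_⟩
  intro z hz w hw h
  simp only [Complex.mul_re] at h
  by_contra hne
  have h1 : (z - w).re = r * (z - w).im := by
    simp only [Complex.sub_re, Complex.sub_im]
    linarith
  by_cases him : (z - w).im = 0
  · rw [him, mul_zero] at h1
    exact hne (sub_eq_zero.1 (Complex.ext h1 him))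
  · exact hr ⟨(z, w), ⟨hz, hw⟩, (div_eq_iff him).2 h1⟩

/-- The fundamental group of the complement of finitely many points of `ℂ` is residually
nilpotent. -/
theorem nilpotentResidue_punctured {P : Set ℂ} (hP : P.Finite) (x₀ : (Pᶜ : Set ℂ)) :
    LowerCentral.nilpotentResidue (FundamentalGroup (Pᶜ : Set ℂ) x₀) = ⊥ := by
  obtain ⟨l, hl, hinj⟩ := exists_ne_zero_injOn_re_mul (hP.insert (x₀ : ℂ))
  let P' : Set ℂ := (fun z => l * z) '' P
  let f : C((Pᶜ : Set ℂ), (P'ᶜ : Set ℂ)) :=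
    { toFun := fun z => ⟨l * z, by
        rintro ⟨p, hp, hpz⟩
        exact z.2 (mul_left_cancel₀ hl hpz ▸ hp)⟩
      continuous_toFun := by fun_prop }
  let g : C((P'ᶜ : Set ℂ), (Pᶜ : Set ℂ)) :=
    { toFun := fun z => ⟨l⁻¹ * z, fun h => z.2 ⟨_, h, mul_inv_cancel_left₀ hl _⟩⟩
      continuous_toFun := by fun_prop }
  have hgf : g.comp f = ContinuousMap.id _ := by
    ext z
    exact inv_mul_cancel_left₀ hl _
  refine LowerCentral.nilpotentResidue_eq_bot_of_injective (FundamentalGroup.map f x₀)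
    (FundamentalGroup.map_injective_of_homotopy (g := g)
      (hgf ▸ ContinuousMap.Homotopy.refl _) x₀) ?_
  refine nilpotentResidue_punctured_of_injOn_re (hP.image _) (f x₀) ?_
  have : insert ((f x₀ : ℂ)) P' = (fun z => l * z) '' insert (x₀ : ℂ) P := by
    rw [Set.image_insert_eq]
    rfl
  rw [this]
  rintro _ ⟨z, hz, rfl⟩ _ ⟨w, hw, rfl⟩ h
  exact congrArg (fun z => l * z) (hinj hz hw h)

end PuncturedPlane

/-! ### Induced maps, the Eckmann–Hilton argument, and loops that bound discs. -/

section FundamentalGroupLemmas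

variable {X Y Z : Type*} [TopologicalSpace X] [TopologicalSpace Y] [TopologicalSpace Z]

theorem FundamentalGroup.map_comp_apply (f : C(X, Y)) (g : C(Y, Z)) (x : X)
    (p : FundamentalGroup X x) : FundamentalGroup.map (g.comp f) x p =
      FundamentalGroup.map g (f x) (FundamentalGroup.map f x p) := by
  obtain ⟨p, rfl⟩ := Path.Homotopic.Quotient.mk_surjective p
  rfl

theorem FundamentalGroup.map_eq_one_of_factors [SimplyConnectedSpace Y] (f : C(X, Y))
    (g : C(Y, Z)) (x : X) (p : FundamentalGroup X x) : FundamentalGroup.map (g.comp f) x p =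
      1 := by
  rw [FundamentalGroup.map_comp_apply,
    Subsingleton.elim (FundamentalGroup.map f x p) 1, map_one]

/-- The fundamental group of a space with a continuous multiplication with unit is commutative. -/
theorem FundamentalGroup.commute_of_unital_mul (m : C(X × X, X)) (e : X)
    (hr : ∀ x, m (x, e) = x) (hl : ∀ x, m (e, x) = x) (p q : FundamentalGroup X e) :
    Commute p q := by
  -- The multiplication sends the base point to `m (e, e)`, which equals `e` only propositionally;
  -- the casts carry this.
  have key : ∀ (e' : X) (h : e' = e) (A B : Path.Homotopic.Quotient e e),
      (A.cast h h).trans (B.cast h h) = (B.cast h h).trans (A.cast h h) →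
      A.trans B = B.trans A := by
    rintro _ rfl A B h
    simpa using h
  have hA : ∀ A : Path.Homotopic.Quotient e e, (Path.Homotopic.prod A (.refl e)).map m =
      A.cast (hr e) (hr e) := by
    intro A
    obtain ⟨a, rfl⟩ := Path.Homotopic.Quotient.mk_surjective A
    refine congrArg Path.Homotopic.Quotient.mk ?_
    ext t
    exact hr (a t)
  have hB : ∀ B : Path.Homotopic.Quotient e e, (Path.Homotopic.prod (.refl e) B).map m =
      B.cast (hr e) (hr e) := by
    intro B
    obtain ⟨b, rfl⟩ := Path.Homotopic.Quotient.mk_surjective B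
    refine congrArg Path.Homotopic.Quotient.mk ?_
    ext t
    exact hl (b t)
  have hmt : ∀ A B : Path.Homotopic.Quotient (e, e) (e, e),
      (A.trans B).map m = (A.map m).trans (B.map m) := by
    intro A B
    obtain ⟨a, rfl⟩ := Path.Homotopic.Quotient.mk_surjective A
    obtain ⟨b, rfl⟩ := Path.Homotopic.Quotient.mk_surjective B
    refine congrArg Path.Homotopic.Quotient.mk ?_
    exact Path.map_trans _ _ _
  refine key (m (e, e)) (hr e) q p ?_
  rw [← hA, ← hB, ← hmt, ← hmt, Path.Homotopic.comp_prod_eq_prod_comp,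
    Path.Homotopic.comp_prod_eq_prod_comp]
  simp

/-- A map kills the class of `γ β γ⁻¹` if it makes `β` null-homotopic. -/
theorem FundamentalGroup.map_lasso_eq_one (f : C(X, Y)) {x y : X} (γ : Path x y) (β : Path y y)
    (h : (β.map f.continuous).Homotopic (Path.refl (f y))) :
    FundamentalGroup.map f x (FundamentalGroup.fromPath (.mk ((γ.trans β).trans γ.symm))) = 1 := by
  change Path.Homotopic.Quotient.mk (((γ.trans β).trans γ.symm).map f.continuous) =
    Path.Homotopic.Quotient.refl (f x)
  rw [Path.map_trans, Path.map_trans]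
  simp only [Path.Homotopic.Quotient.mk_trans]
  rw [Path.Homotopic.Quotient.eq.2 h, Path.Homotopic.Quotient.mk_refl,
    Path.Homotopic.Quotient.trans_refl, ← Path.map_symm, Path.Homotopic.Quotient.mk_symm,
    Path.Homotopic.Quotient.trans_symm]

/-- The standard parametrization of the unit circle, as a loop in the closed unit disk. -/
noncomputable def diskBoundary :
    Path (⟨1, by simp⟩ : Metric.closedBall (0 : ℂ) 1) ⟨1, by simp⟩ where
  toFun t := ⟨Complex.exp (2 * Real.pi * Complex.I * ((t : ℝ) : ℂ)), by
    rw [mem_closedBall_zero_iff, Complex.norm_exp]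
    simp⟩
  continuous_toFun := by fun_prop
  source' := by simp
  target' := by simp

theorem Path.homotopic_refl_of_disk (D : C(Metric.closedBall (0 : ℂ) 1, Y)) {y : Y}
    (β : Path y y) (h : ∀ t, β t = D (diskBoundary t)) : β.Homotopic (Path.refl y) := by
  have : ContractibleSpace (Metric.closedBall (0 : ℂ) 1) :=
    (convex_closedBall (0 : ℂ) 1).contractibleSpace ⟨0, by simp⟩
  have h1 := (SimplyConnectedSpace.paths_homotopic diskBoundary
    (Path.refl (⟨1, by simp⟩ : Metric.closedBall (0 : ℂ) 1))).map D
  have hy : y = D ⟨1, by simp⟩ := by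
    rw [← β.source, h 0, diskBoundary.source]
  have h2 := h1.pathCast hy hy
  convert h2 using 1
  · ext t
    exact h t
  · ext t
    exact hy

end FundamentalGroupLemmas

/-! ### The winding number -/

theorem exists_zmultiples_hom :
    ∃ h : AddSubgroup.zmultiples (2 * Real.pi * Complex.I) →+ ℤ,
      h ⟨_, AddSubgroup.mem_zmultiples _⟩ = 1 := by
  have hinj : ∀ m n : ℤ, m • (2 * Real.pi * Complex.I) = n • (2 * Real.pi * Complex.I) → m = n :=
    fun m n h => smul_left_injective ℤ Complex.two_pi_I_ne_zero h
  choose f hf using fun g : AddSubgroup.zmultiples (2 * Real.pi * Complex.I) =>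
    AddSubgroup.mem_zmultiples_iff.1 g.2
  refine ⟨AddMonoidHom.mk' f fun a b => hinj _ _ ?_, hinj _ _ ?_⟩
  · rw [add_smul, hf, hf, hf]
    rfl
  · rw [one_smul]
    exact hf _

/-- The winding number around the origin, as a homomorphism. -/
theorem exists_winding_hom (z₀ : {z : ℂ // z ≠ 0}) :
    ∃ w : FundamentalGroup {z : ℂ // z ≠ 0} z₀ →* Multiplicative ℤ,
      ∀ (y : {z : ℂ // z ≠ 0}) (γ : Path z₀ y) (β : Path y y),
        (∀ t, (β t : ℂ) = Complex.exp (2 * Real.pi * Complex.I * ((t : ℝ) : ℂ)) * y) →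
        w (FundamentalGroup.fromPath (.mk ((γ.trans β).trans γ.symm))) =
          Multiplicative.ofAdd 1 := by
  have hp := Complex.isAddQuotientCoveringMap_exp
  let pr : ℂ → {z : ℂ // z ≠ 0} := fun z => ⟨_, z.exp_ne_zero⟩
  obtain ⟨h, hh⟩ := exists_zmultiples_hom
  let e : pr ⁻¹' {z₀} := ⟨Complex.log z₀, Subtype.ext (Complex.exp_log z₀.2)⟩
  let op' : (Multiplicative (AddSubgroup.zmultiples (2 * Real.pi * Complex.I)))ᵐᵒᵖ →*
      Multiplicative (AddSubgroup.zmultiples (2 * Real.pi * Complex.I)) :=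
    { toFun := MulOpposite.unop
      map_one' := rfl
      map_mul' := fun a b => mul_comm _ _ }
  refine ⟨(AddMonoidHom.toMultiplicative h).comp
    (op'.comp (hp.fundamentalGroupToMulOpposite e)), ?_⟩
  intro y γ β hβ
  let g : AddSubgroup.zmultiples (2 * Real.pi * Complex.I) := ⟨_, AddSubgroup.mem_zmultiples _⟩
  have key : hp.fundamentalGroupToMulOpposite e
      (FundamentalGroup.fromPath (.mk ((γ.trans β).trans γ.symm))) =
      MulOpposite.op (Multiplicative.ofAdd g) := by
    rw [hp.fundamentalGroupToMulOpposite_apply_eq_Iff]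
    change 2 * Real.pi * Complex.I + (e : ℂ) = (hp.isCoveringMap.monodromy
      (.mk ((γ.trans β).trans γ.symm)) e : ℂ)
    rw [Path.Homotopic.Quotient.mk_trans, Path.Homotopic.Quotient.mk_trans,
      hp.isCoveringMap.monodromy_trans_apply, hp.isCoveringMap.monodromy_trans_apply]
    set e₁ := hp.isCoveringMap.monodromy (.mk γ) e
    -- The circle lifts to the straight segment from `e₁` to `e₁ + 2πi`.
    have hβ' : hp.isCoveringMap.monodromy (.mk β) e₁ =
        hp.toMultiplicative.toPermFiber y (Multiplicative.ofAdd g) e₁ := by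
      let Γ : Path (e₁ : ℂ) (2 * Real.pi * Complex.I + e₁) :=
        { toFun := fun t => 2 * Real.pi * Complex.I * ((t : ℝ) : ℂ) + e₁
          continuous_toFun := by fun_prop
          source' := by simp
          target' := by simp }
      refine hp.isCoveringMap.monodromy_eq_of_map_eq (.mk Γ) ?_
      refine congrArg Path.Homotopic.Quotient.mk ?_
      ext t
      change Complex.exp (2 * Real.pi * Complex.I * ((t : ℝ) : ℂ) + e₁) = β t
      rw [hβ, Complex.exp_add]
      congr 1
      exact congrArg Subtype.val e₁.2
    -- Deck translations commute with monodromy, so the shift survives the way back along `γ`.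
    have hγ' : hp.isCoveringMap.monodromy (.mk γ.symm)
        (hp.toMultiplicative.toPermFiber y (Multiplicative.ofAdd g) e₁) =
        hp.toMultiplicative.toPermFiber z₀ (Multiplicative.ofAdd g)
          (hp.isCoveringMap.monodromy (.mk γ.symm) e₁) :=
      hp.toMultiplicative.monodromy_toPermFiber
    rw [hβ', hγ']
    have hback : hp.isCoveringMap.monodromy (.mk γ.symm) e₁ = e := by
      rw [← hp.isCoveringMap.monodromy_trans_apply, Path.Homotopic.Quotient.mk_symm,
        Path.Homotopic.Quotient.trans_symm, hp.isCoveringMap.monodromy_refl]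
      rfl
    rw [hback]
    rfl
  change Multiplicative.ofAdd (h (Multiplicative.toAdd (MulOpposite.unop
    (hp.fundamentalGroupToMulOpposite e _)))) = _
  rw [key]
  exact congrArg Multiplicative.ofAdd hh

/-! ### Complements of complex hyperplanes -/

section Avoiding

variable {E : Type*} [NormedAddCommGroup E] [NormedSpace ℂ E]

/-- The complement of a set of affine subspaces. -/
def avoiding (S : Set (AffineSubspace ℂ E)) : Set E := {x | ∀ H ∈ S, x ∉ H}

/-- `φ` is a linear functional that cuts out the hyperplane `H` through `p`. -/
def CutsOut (φ : E →L[ℂ] ℂ) (p : E) (H : AffineSubspace ℂ E) : Prop :=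
  ∀ x, x ∈ H ↔ φ (x - p) = 0

/-- With dual vectors `u H`, the sum `x + y - e` can be corrected so that every functional becomes
multiplicative, normalized by its value at `e`. This is a multiplication on the complement with unit
`e`, so Eckmann–Hilton applies. -/
theorem commute_fundamentalGroup_avoiding {S : Set (AffineSubspace ℂ E)} (hS : S.Finite) (p : E)
    (φ : AffineSubspace ℂ E → E →L[ℂ] ℂ) (hφ : ∀ H ∈ S, CutsOut (φ H) p H)
    (u : AffineSubspace ℂ E → E) (hu : ∀ H ∈ S, φ H (u H) = 1)
    (hu' : ∀ H ∈ S, ∀ K ∈ S, K ≠ H → φ K (u H) = 0) (e : avoiding S)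
    (a b : FundamentalGroup (avoiding S) e) : Commute a b := by
  classical
  have hne : ∀ x : avoiding S, ∀ H ∈ S, φ H ((x : E) - p) ≠ 0 := fun x H hH h =>
    x.2 H hH ((hφ H hH x).2 h)
  let m₀ : avoiding S × avoiding S → E := fun x => (x.1 : E) + x.2 - e +
    ∑ H ∈ hS.toFinset, (φ H ((x.1 : E) - p) * φ H ((x.2 : E) - p) / φ H ((e : E) - p) -
      φ H ((x.1 : E) - p) - φ H ((x.2 : E) - p) + φ H ((e : E) - p)) • u H
  have hm : ∀ x, ∀ H ∈ S, φ H (m₀ x - p) =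
      φ H ((x.1 : E) - p) * φ H ((x.2 : E) - p) / φ H ((e : E) - p) := by
    intro x H hH
    have h1 : m₀ x - p = ((x.1 : E) - p) + ((x.2 : E) - p) - ((e : E) - p) +
        ∑ H ∈ hS.toFinset, (φ H ((x.1 : E) - p) * φ H ((x.2 : E) - p) / φ H ((e : E) - p) -
        φ H ((x.1 : E) - p) - φ H ((x.2 : E) - p) + φ H ((e : E) - p)) • u H := by
      simp only [m₀]
      abel
    rw [h1, map_add, map_sub, map_add, map_sum, Finset.sum_eq_single H]
    · rw [map_smul, hu H hH, smul_eq_mul]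
      ring
    · intro K hK hKH
      rw [map_smul, hu' K (hS.mem_toFinset.1 hK) H hH hKH.symm, smul_zero]
    · intro h
      exact absurd (hS.mem_toFinset.2 hH) h
  let m : C(avoiding S × avoiding S, avoiding S) :=
    { toFun := fun x => ⟨m₀ x, fun H hH h => by
        rw [hφ H hH, hm x H hH] at h
        exact div_ne_zero (mul_ne_zero (hne _ H hH) (hne _ H hH)) (hne _ H hH) h⟩
      continuous_toFun := by
        refine Continuous.subtype_mk ?_ _
        simp only [m₀, div_eq_mul_inv]
        fun_prop }
  refine FundamentalGroup.commute_of_unital_mul m e (fun x => ?_) (fun x => ?_) a b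
  · refine Subtype.ext ?_
    change m₀ (x, e) = x
    simp only [m₀]
    rw [Finset.sum_eq_zero, add_sub_cancel_right, add_zero]
    intro H hH
    rw [mul_div_cancel_right₀ _ (hne e H (hS.mem_toFinset.1 hH))]
    simp
  · refine Subtype.ext ?_
    change m₀ (e, x) = x
    simp only [m₀]
    rw [Finset.sum_eq_zero, add_sub_cancel_left, add_zero]
    intro H hH
    rw [mul_div_cancel_left₀ _ (hne e H (hS.mem_toFinset.1 hH))]
    simp

theorem nilpotentResidue_fundamentalGroup_prod {X Y : Type*} [TopologicalSpace X]
    [TopologicalSpace Y] (z : X × Y)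
    (hX : LowerCentral.nilpotentResidue (FundamentalGroup X z.1) = ⊥)
    (hY : LowerCentral.nilpotentResidue (FundamentalGroup Y z.2) = ⊥) :
    LowerCentral.nilpotentResidue (FundamentalGroup (X × Y) z) = ⊥ := by
  obtain ⟨x, y⟩ := z
  rw [eq_bot_iff]
  intro g hg
  have h1 := LowerCentral.map_mem_nilpotentResidue
    (FundamentalGroup.map (⟨Prod.fst, continuous_fst⟩ : C(X × Y, X)) (x, y)) hg
  have h2 := LowerCentral.map_mem_nilpotentResidue
    (FundamentalGroup.map (⟨Prod.snd, continuous_snd⟩ : C(X × Y, Y)) (x, y)) hg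
  have h1' : Path.Homotopic.projLeft g = .refl x := (hX.le h1 :)
  have h2' : Path.Homotopic.projRight g = .refl y := (hY.le h2 :)
  have h3 := Path.Homotopic.prod_projLeft_projRight g
  rw [h1', h2'] at h3
  exact h3.symm

/-- The complement of a central arrangement of rank two has a residually nilpotent fundamental
group. -/
theorem nilpotentResidue_avoiding {S : Set (AffineSubspace ℂ E)} (hS : S.Finite) (p : E)
    (φ : AffineSubspace ℂ E → E →L[ℂ] ℂ) (hφ : ∀ H ∈ S, CutsOut (φ H) p H)
    {H₀ H₁ : AffineSubspace ℂ E} (h₀ : H₀ ∈ S) {u₀ u₁ : E}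
    (h00 : φ H₀ u₀ = 1) (h01 : φ H₀ u₁ = 0) (h10 : φ H₁ u₀ = 0) (h11 : φ H₁ u₁ = 1)
    (hker : ∀ H ∈ S, ∀ v, φ H₀ v = 0 → φ H₁ v = 0 → φ H v = 0)
    (hinc : ∀ H ∈ S, (∀ v, φ H₀ v = 0 → φ H v = 0) → H = H₀) (e : avoiding S) :
    LowerCentral.nilpotentResidue (FundamentalGroup (avoiding S) e) = ⊥ := by
  have hdec : ∀ H ∈ S, ∀ v, φ H v = φ H₀ v * φ H u₀ + φ H₁ v * φ H u₁ := by
    intro H hH v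
    have h := hker H hH (v - φ H₀ v • u₀ - φ H₁ v • u₁) (by simp [h00, h01])
      (by simp [h10, h11])
    simp only [map_sub, map_smul, smul_eq_mul] at h
    linear_combination h
  have hne : ∀ x : avoiding S, ∀ H ∈ S, φ H ((x : E) - p) ≠ 0 := fun x H hH h =>
    x.2 H hH ((hφ H hH x).2 h)
  -- In the coordinates `z = φ H₀` and `t = φ H₁ / φ H₀`, every functional is `z * (φ H u₀ + t * φ H
  -- u₁)`; the punctures are the slopes of the hyperplanes other than `H₀`.
  let P : Set ℂ := ⋃ H ∈ S \ {H₀}, {t | φ H u₀ + t * φ H u₁ = 0}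
  have hP : P.Finite := by
    refine hS.sdiff.biUnion fun H hH => Set.Subsingleton.finite ?_
    intro t ht s hs
    have hb : φ H u₁ ≠ 0 := by
      intro hb
      refine hH.2 (hinc H hH.1 fun v hv => ?_)
      rw [hdec H hH.1, hv, hb]
      ring
    have h : (t - s) * φ H u₁ = 0 := by
      have h1 : φ H u₀ + t * φ H u₁ = 0 := ht
      have h2 : φ H u₀ + s * φ H u₁ = 0 := hs
      linear_combination h1 - h2
    exact sub_eq_zero.1 ((mul_eq_zero.1 h).resolve_right hb)
  have hPmem : ∀ H ∈ S, H ≠ H₀ → ∀ t ∉ P, φ H u₀ + t * φ H u₁ ≠ 0 := by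
    intro H hH hne t ht h
    exact ht (Set.mem_biUnion (⟨hH, hne⟩ : H ∈ S \ {H₀}) h)
  let f : C(avoiding S, ({0}ᶜ : Set ℂ) × (Pᶜ : Set ℂ)) :=
    { toFun := fun x => (⟨φ H₀ ((x : E) - p), hne x H₀ h₀⟩,
        ⟨φ H₁ ((x : E) - p) / φ H₀ ((x : E) - p), by
          intro h
          obtain ⟨H, hH, hz⟩ := Set.mem_iUnion₂.1 h
          apply hne x H hH.1
          rw [hdec H hH.1]
          have hz' : φ H u₀ + φ H₁ ((x : E) - p) / φ H₀ ((x : E) - p) * φ H u₁ = 0 := hz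
          have h0 := hne x H₀ h₀
          field_simp at hz'
          linear_combination hz'⟩)
      continuous_toFun := by
        refine Continuous.prodMk (Continuous.subtype_mk (by fun_prop) _)
          (Continuous.subtype_mk ?_ _)
        exact Continuous.div (by fun_prop) (by fun_prop) fun x => hne x H₀ h₀ }
  have hψ : ∀ (z : ℂ) (t : ℂ), ∀ H ∈ S, φ H (p + z • u₀ + (z * t) • u₁ - p) =
      z * (φ H u₀ + t * φ H u₁) := by
    intro z t H _
    have : p + z • u₀ + (z * t) • u₁ - p = z • u₀ + (z * t) • u₁ := by abel
    rw [this, map_add, map_smul, map_smul, smul_eq_mul, smul_eq_mul]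
    ring
  let g : C(({0}ᶜ : Set ℂ) × (Pᶜ : Set ℂ), avoiding S) :=
    { toFun := fun x => ⟨p + (x.1 : ℂ) • u₀ + ((x.1 : ℂ) * x.2) • u₁, by
        intro H hH h
        rw [hφ H hH, hψ _ _ H hH] at h
        have hz : (x.1 : ℂ) ≠ 0 := x.1.2
        rcases mul_eq_zero.1 h with h | h
        · exact hz h
        · by_cases hH₀ : H = H₀
          · subst hH₀
            rw [h00, h01] at h
            simp at h
          · exact hPmem H hH hH₀ _ x.2.2 h⟩
      continuous_toFun := by fun_prop }
  -- The composite moves a point only along the common kernel of the functionals, so every value `φ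
  -- H` stays constant on the segment.
  have F : (g.comp f).Homotopy (ContinuousMap.id (avoiding S)) := by
    refine ContinuousMap.homotopyOfSegment _ _ fun x t _ _ => ?_
    intro H hH h
    have hgf : ((g.comp f x : avoiding S) : E) = p + φ H₀ ((x : E) - p) • u₀ +
        (φ H₀ ((x : E) - p) * (φ H₁ ((x : E) - p) / φ H₀ ((x : E) - p))) • u₁ := rfl
    have h1 : ∀ K ∈ S, φ K (((g.comp f x : avoiding S) : E) - p) = φ K ((x : E) - p) := by
      intro K hK
      rw [hgf, hψ _ _ K hK, hdec K hK ((x : E) - p)]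
      have h0 := hne x H₀ h₀
      field_simp
    rw [hφ H hH] at h
    apply hne x H hH
    rw [← h, ContinuousMap.id_apply]
    have h2 : ((g.comp f x : avoiding S) : E) + t • ((x : E) - (g.comp f x : avoiding S)) - p =
        (((g.comp f x : avoiding S) : E) - p) +
        (t : ℂ) • (((x : E) - p) - (((g.comp f x : avoiding S) : E) - p)) := by
      rw [Complex.coe_smul]
      module
    rw [h2, map_add, map_smul, map_sub (φ H) ((x : E) - p), h1 H hH, sub_self, smul_zero, add_zero]
  refine LowerCentral.nilpotentResidue_eq_bot_of_injective (FundamentalGroup.map f e)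
    (FundamentalGroup.map_injective_of_homotopy F e) ?_
  exact nilpotentResidue_fundamentalGroup_prod _
    (nilpotentResidue_punctured (Set.finite_singleton 0) _) (nilpotentResidue_punctured hP _)

/-- The radial contraction of `E` into the ball of radius `r` around `p`. -/
noncomputable def radialShrink (p : E) (r : ℝ) (x : E) : E :=
  p + ((r / (1 + ‖x - p‖) : ℝ) : ℂ) • (x - p)

theorem continuous_radialShrink (p : E) (r : ℝ) : Continuous (radialShrink p r) := by
  unfold radialShrink
  have h : Continuous fun x : E => r / (1 + ‖x - p‖) :=
    continuous_const.div (by fun_prop) fun x => by positivity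
  fun_prop

theorem radialShrink_mem_ball (p : E) {r : ℝ} (hr : 0 < r) (x : E) :
    radialShrink p r x ∈ Metric.ball p r := by
  rw [mem_ball_iff_norm, radialShrink, add_sub_cancel_left, norm_smul, Complex.norm_real,
    Real.norm_of_nonneg (by positivity), div_mul_eq_mul_div, div_lt_iff₀ (by positivity)]
  nlinarith [norm_nonneg (x - p)]

/-- Along the segment `x - p` is only rescaled by a positive real number, so no hyperplane through
`p` is entered or left. -/
theorem segment_radialShrink_mem_iff {φ : E →L[ℂ] ℂ} {p : E} {H : AffineSubspace ℂ E}
    (hφ : CutsOut φ p H) {r : ℝ} (hr : 0 < r) (x : E) {t : ℝ} (ht0 : 0 ≤ t) (ht1 : t ≤ 1) :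
    x + (t : ℂ) • (radialShrink p r x - x) ∈ H ↔ x ∈ H := by
  have h1 : x + (t : ℂ) • (radialShrink p r x - x) - p =
      ((1 - t + t * (r / (1 + ‖x - p‖)) : ℝ) : ℂ) • (x - p) := by
    rw [radialShrink]
    push_cast
    module
  have hpos : 0 < 1 - t + t * (r / (1 + ‖x - p‖)) := by
    have : 0 < r / (1 + ‖x - p‖) := by positivity
    rcases ht1.lt_or_eq with h | h
    · have := mul_nonneg ht0 this.le
      linarith
    · subst h
      linarith
  rw [hφ, hφ, h1, map_smul, smul_eq_zero]
  have : ((1 - t + t * (r / (1 + ‖x - p‖)) : ℝ) : ℂ) ≠ 0 := Complex.ofReal_ne_zero.2 hpos.ne'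
  exact or_iff_right this

theorem radialShrink_mem_iff {φ : E →L[ℂ] ℂ} {p : E} {H : AffineSubspace ℂ E}
    (hφ : CutsOut φ p H) {r : ℝ} (hr : 0 < r) (x : E) :
    radialShrink p r x ∈ H ↔ x ∈ H := by
  have := segment_radialShrink_mem_iff hφ hr x zero_le_one le_rfl
  simpa using this

/-- Any two points in the complement of finitely many hyperplanes can be joined. -/
theorem joinedIn_avoiding {S : Set (AffineSubspace ℂ E)} (hS : S.Finite)
    (hcut : ∀ H ∈ S, ∃ (φ : E →L[ℂ] ℂ) (p : E), CutsOut φ p H) {x y : E}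
    (hx : x ∈ avoiding S) (hy : y ∈ avoiding S) : JoinedIn (avoiding S) x y := by
  -- The complex line through `x` and `y` meets each hyperplane at most once, since `x` lies on
  -- none; its punctured copy of `ℂ` is path connected.
  let B : Set ℂ := ⋃ H ∈ S, {z | x + z • (y - x) ∈ H}
  have hB : B.Finite := by
    refine hS.biUnion fun H hH => Set.Subsingleton.finite ?_
    obtain ⟨φ, p, hφ⟩ := hcut H hH
    intro z hz w hw
    have hval : ∀ z : ℂ, x + z • (y - x) ∈ H ↔ φ (x - p) + z * φ (y - x) = 0 := by
      intro z
      rw [hφ, add_sub_right_comm, map_add, map_smul, smul_eq_mul]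
    have h1 := (hval z).1 hz
    have h2 := (hval w).1 hw
    have h3 : φ (y - x) ≠ 0 := by
      intro h
      rw [h, mul_zero, add_zero] at h1
      exact hx H hH ((hφ x).2 h1)
    have h4 : (z - w) * φ (y - x) = 0 := by linear_combination h1 - h2
    exact sub_eq_zero.1 ((mul_eq_zero.1 h4).resolve_right h3)
  have hpc : IsPathConnected Bᶜ := hB.countable.isPathConnected_compl_of_one_lt_rank (by
    rw [Complex.rank_real_complex]
    exact Cardinal.one_lt_two)
  have h0 : (0 : ℂ) ∈ Bᶜ := by
    intro h
    obtain ⟨H, hH, hz⟩ := Set.mem_iUnion₂.1 h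
    exact hx H hH (by simpa using hz)
  have h1 : (1 : ℂ) ∈ Bᶜ := by
    intro h
    obtain ⟨H, hH, hz⟩ := Set.mem_iUnion₂.1 h
    exact hy H hH (by simpa using hz)
  have hj := (hpc.joinedIn 0 h0 1 h1).map_continuousOn (f := fun z : ℂ => x + z • (y - x))
    (by fun_prop)
  have hj' : JoinedIn ((fun z : ℂ => x + z • (y - x)) '' Bᶜ) x y := by simpa using hj
  refine hj'.mono ?_
  rintro _ ⟨z, hz, rfl⟩ H hH h
  exact hz (Set.mem_biUnion hH h)

end Avoiding

/-! ### Local sections -/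

section LocalSection

variable {X Y Z W : Type*} [TopologicalSpace X] [TopologicalSpace Y] [TopologicalSpace Z]
  [TopologicalSpace W]

/-- The change of base point along a path. -/
noncomputable def FundamentalGroup.conjPath {x y : X} (δ : Path x y) :
    FundamentalGroup X y →* FundamentalGroup X x where
  toFun q := (Path.Homotopic.Quotient.mk δ).trans
    (Path.Homotopic.Quotient.trans q (Path.Homotopic.Quotient.mk δ).symm)
  map_one' := by
    change (Path.Homotopic.Quotient.mk δ).trans ((Path.Homotopic.Quotient.refl y).trans _) =
      Path.Homotopic.Quotient.refl x
    simp
  map_mul' a b := by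
    change (Path.Homotopic.Quotient.mk δ).trans
      (Path.Homotopic.Quotient.trans (Path.Homotopic.Quotient.trans b a) _) =
      Path.Homotopic.Quotient.trans ((Path.Homotopic.Quotient.mk δ).trans
        (Path.Homotopic.Quotient.trans b _)) ((Path.Homotopic.Quotient.mk δ).trans
        (Path.Homotopic.Quotient.trans a _))
    simp only [Path.Homotopic.Quotient.trans_assoc]
    rw [← Path.Homotopic.Quotient.trans_assoc (Path.Homotopic.Quotient.mk δ).symm,
      Path.Homotopic.Quotient.symm_trans, Path.Homotopic.Quotient.refl_trans]

theorem FundamentalGroup.map_conjPath (f : C(X, Y)) {x y : X} (δ : Path x y)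
    (q : FundamentalGroup X y) : FundamentalGroup.map f x (FundamentalGroup.conjPath δ q) =
      FundamentalGroup.conjPath (δ.map f.continuous) (FundamentalGroup.map f y q) := by
  obtain ⟨q, rfl⟩ := Path.Homotopic.Quotient.mk_surjective q
  change Path.Homotopic.Quotient.mk ((δ.trans (q.trans δ.symm)).map f.continuous) =
    Path.Homotopic.Quotient.mk ((δ.map f.continuous).trans
      ((q.map f.continuous).trans (δ.map f.continuous).symm))
  rw [Path.map_trans, Path.map_trans, Path.map_symm]

/-- The homomorphism of fundamental groups induced by a map, with a change of base point. -/
noncomputable def FundamentalGroup.mapAlong (c : C(Y, X)) {e : X} {y : Y} (δ : Path e (c y)) :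
    FundamentalGroup Y y →* FundamentalGroup X e :=
  (FundamentalGroup.conjPath δ).comp (FundamentalGroup.map c y)

theorem FundamentalGroup.map_mapAlong (c : C(Y, X)) {e : X} {y : Y} (δ : Path e (c y))
    (g : C(X, Z)) (q : FundamentalGroup Y y) :
    FundamentalGroup.map g e (FundamentalGroup.mapAlong c δ q) =
      FundamentalGroup.conjPath (δ.map g.continuous) (FundamentalGroup.map (g.comp c) y q) := by
  rw [FundamentalGroup.map_comp_apply]
  exact FundamentalGroup.map_conjPath g δ _

theorem FundamentalGroup.commute_map_mapAlong (c : C(Y, X)) {e : X} {y : Y} (δ : Path e (c y))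
    (g : C(X, Z)) (h : C(Y, W)) (k : C(W, Z)) (hgc : ∀ x, g (c x) = k (h x))
    (hW : ∀ a b : FundamentalGroup W (h y), Commute a b) (q r : FundamentalGroup Y y) :
    Commute (FundamentalGroup.map g e (FundamentalGroup.mapAlong c δ q))
      (FundamentalGroup.map g e (FundamentalGroup.mapAlong c δ r)) := by
  have key : ∀ f : C(Y, Z), f = k.comp h →
      Commute (FundamentalGroup.map f y q) (FundamentalGroup.map f y r) := by
    rintro _ rfl
    rw [FundamentalGroup.map_comp_apply, FundamentalGroup.map_comp_apply]
    exact (hW _ _).map _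
  rw [FundamentalGroup.map_mapAlong, FundamentalGroup.map_mapAlong]
  exact (key (g.comp c) (ContinuousMap.ext hgc)).map (FundamentalGroup.conjPath _)

theorem FundamentalGroup.map_mapAlong_eq_one [SimplyConnectedSpace W] (c : C(Y, X)) {e : X}
    {y : Y} (δ : Path e (c y)) (g : C(X, Z)) (h : C(Y, W)) (k : C(W, Z))
    (hgc : ∀ x, g (c x) = k (h x)) (q : FundamentalGroup Y y) :
    FundamentalGroup.map g e (FundamentalGroup.mapAlong c δ q) = 1 := by
  have key : ∀ f : C(Y, Z), f = k.comp h → FundamentalGroup.map f y q = 1 := by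
    rintro _ rfl
    exact FundamentalGroup.map_eq_one_of_factors h k y q
  rw [FundamentalGroup.map_mapAlong]
  exact (congrArg (FundamentalGroup.conjPath (δ.map g.continuous))
    (key (g.comp c) (ContinuousMap.ext hgc))).trans (map_one (FundamentalGroup.conjPath _))

/-- The homotopy inverse `c` moves the base point. The conjugating element compares its track under
the homotopy with the chosen return path `δ`. -/
theorem FundamentalGroup.exists_map_mapAlong_eq_conj (f : C(X, Y)) (c : C(Y, X)) {e : X}
    (δ : Path e (c (f e))) (F : (ContinuousMap.id Y).Homotopy (f.comp c)) :
    ∃ l : FundamentalGroup Y (f e), ∀ q : FundamentalGroup Y (f e),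
      FundamentalGroup.map f e (FundamentalGroup.mapAlong c δ q) = l * q * l⁻¹ := by
  let ev : Path.Homotopic.Quotient (f e) (f (c (f e))) := .mk (F.evalAt (f e))
  let δ' : Path.Homotopic.Quotient (f e) (f (c (f e))) := .mk (δ.map f.continuous)
  refine ⟨FundamentalGroup.fromPath (ev.trans δ'.symm), fun q => ?_⟩
  have h1 : Path.Homotopic.Quotient.trans q ev =
      ev.trans (FundamentalGroup.map (f.comp c) (f e) q) := by
    have h := FundamentalGroup.map_trans_evalAt F q
    have h2 : FundamentalGroup.map (ContinuousMap.id Y) (f e) q = q := by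
      obtain ⟨q, rfl⟩ := Path.Homotopic.Quotient.mk_surjective q
      rfl
    rwa [h2] at h
  rw [FundamentalGroup.map_mapAlong]
  have h3 : (FundamentalGroup.fromPath (ev.trans δ'.symm))⁻¹ =
      FundamentalGroup.fromPath (δ'.trans ev.symm) := by
    rw [inv_eq_iff_mul_eq_one]
    change Path.Homotopic.Quotient.trans (δ'.trans ev.symm) (ev.trans δ'.symm) =
      Path.Homotopic.Quotient.refl _
    rw [Path.Homotopic.Quotient.trans_assoc, ← Path.Homotopic.Quotient.trans_assoc ev.symm]
    simp
  rw [h3]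
  change δ'.trans (Path.Homotopic.Quotient.trans
      (FundamentalGroup.map (f.comp c) (f e) q) δ'.symm) =
    (δ'.trans ev.symm).trans (Path.Homotopic.Quotient.trans q (ev.trans δ'.symm))
  rw [Path.Homotopic.Quotient.trans_assoc, ← Path.Homotopic.Quotient.trans_assoc q, h1,
    Path.Homotopic.Quotient.trans_assoc, ← Path.Homotopic.Quotient.trans_assoc ev.symm]
  simp

end LocalSection

/-! ### Local sections, generic points and meridians. -/

section Avoiding

variable {E : Type*} [NormedAddCommGroup E] [NormedSpace ℂ E]

/-- Inside a ball that misses the hyperplanes of `S` outside `T`, the inclusion of complements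
induces a surjection on fundamental groups that splits up to conjugation. -/
theorem exists_localSection {S T : Set (AffineSubspace ℂ E)} (hS : S.Finite)
    (hcut : ∀ H ∈ S, ∃ (φ : E →L[ℂ] ℂ) (p : E), CutsOut φ p H) (p : E)
    (φ : AffineSubspace ℂ E → E →L[ℂ] ℂ) (hφ : ∀ H ∈ T, CutsOut (φ H) p H) {r : ℝ} (hr : 0 < r)
    (hball : ∀ H ∈ S, H ∉ T → ∀ x ∈ Metric.ball p r, x ∉ H) (e : avoiding S)
    (ι : C(avoiding S, avoiding T)) (hι : ∀ x, (ι x : E) = x) :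
    ∃ s : FundamentalGroup (avoiding T) (ι e) →* FundamentalGroup (avoiding S) e,
      (∃ l, ∀ q, FundamentalGroup.map ι e (s q) = l * q * l⁻¹) ∧
      (∀ U ⊆ S, (∀ (e' : avoiding (T ∩ U)) (a b : FundamentalGroup (avoiding (T ∩ U)) e'),
          Commute a b) →
        ∀ κ : C(avoiding S, avoiding U), (∀ x, (κ x : E) = x) → ∀ q q',
          Commute (FundamentalGroup.map κ e (s q)) (FundamentalGroup.map κ e (s q'))) ∧
      (∀ H ∈ S, H ∉ T → ∀ (ψ : E →L[ℂ] ℂ) (p' : E), CutsOut ψ p' H →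
        ∀ f : C(avoiding S, {z : ℂ // z ≠ 0}), (∀ x, (f x : ℂ) = ψ ((x : E) - p')) →
          ∀ q, FundamentalGroup.map f e (s q) = 1) := by
  -- Hyperplanes outside `T` miss the ball, so after shrinking only those in `T ∩ U` can obstruct.
  -- With `U = S` this defines the section; for smaller `U` it gives the factorization through a
  -- smaller complement.
  have hmem : ∀ U ⊆ S, ∀ x ∈ avoiding (T ∩ U), radialShrink p r x ∈ avoiding U := by
    intro U hU x hx H hH h
    by_cases hT : H ∈ T
    · exact hx H ⟨hT, hH⟩ ((radialShrink_mem_iff (hφ H hT) hr x).1 h)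
    · exact hball H (hU hH) hT _ (radialShrink_mem_ball p hr x) h
  let c : C(avoiding T, avoiding S) :=
    { toFun := fun x => ⟨radialShrink p r x, hmem S subset_rfl x fun H hH => x.2 H hH.1⟩
      continuous_toFun :=
        ((continuous_radialShrink p r).comp continuous_subtype_val).subtype_mk _ }
  obtain ⟨δ, hδ⟩ := joinedIn_avoiding hS hcut e.2 (c (ι e)).2
  let δ' : Path e (c (ι e)) :=
    { toFun := fun t => ⟨δ t, hδ t⟩
      continuous_toFun := δ.continuous.subtype_mk _
      source' := Subtype.ext δ.source
      target' := Subtype.ext δ.target }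
  refine ⟨FundamentalGroup.mapAlong c δ', ?_, ?_, ?_⟩
  · refine FundamentalGroup.exists_map_mapAlong_eq_conj ι c δ' ?_
    refine ContinuousMap.homotopyOfSegment _ _ fun x t ht0 ht1 H hH h => ?_
    rw [ContinuousMap.id_apply, ContinuousMap.comp_apply, hι, ← Complex.coe_smul] at h
    exact x.2 H hH ((segment_radialShrink_mem_iff (hφ H hH) hr (x : E) ht0 ht1).1 h)
  · intro U hU hcomm κ hκ q q'
    let h : C(avoiding T, avoiding (T ∩ U)) :=
      { toFun := fun x => ⟨x, fun H hH => x.2 H hH.1⟩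
        continuous_toFun := by fun_prop }
    let k : C(avoiding (T ∩ U), avoiding U) :=
      { toFun := fun x => ⟨radialShrink p r x, hmem U hU x x.2⟩
        continuous_toFun :=
          ((continuous_radialShrink p r).comp continuous_subtype_val).subtype_mk _ }
    exact FundamentalGroup.commute_map_mapAlong c δ' κ h k
      (fun x => Subtype.ext (hκ (c x))) (hcomm _) q q'
  · intro H hH hT ψ p' hψ f hf q
    -- The value of `ψ` never vanishes on the ball, so it extends through the contractible space
    -- `E`.
    let h : C(avoiding T, E) := ⟨Subtype.val, continuous_subtype_val⟩
    let k : C(E, {z : ℂ // z ≠ 0}) :=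
      { toFun := fun x => ⟨ψ (radialShrink p r x - p'), fun h0 =>
          hball H hH hT _ (radialShrink_mem_ball p hr x) ((hψ _).2 h0)⟩
        continuous_toFun := by
          have := continuous_radialShrink p r
          fun_prop }
    have : ContractibleSpace E := RealTopologicalVectorSpace.contractibleSpace
    exact FundamentalGroup.map_mapAlong_eq_one c δ' f h k (fun x => Subtype.ext (hf (c x))) q

/-- A vector space over an infinite field is not a finite union of proper subspaces; applied in the
direction of `X`, this yields a generic point. -/
theorem exists_mem_forall_notMem {S : Set (AffineSubspace ℂ E)} (hS : S.Finite)
    {X : AffineSubspace ℂ E} {p : E} (hp : p ∈ X) (φ : AffineSubspace ℂ E → E →L[ℂ] ℂ)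
    (hφ : ∀ H ∈ S, CutsOut (φ H) p H) (hX : ∀ H ∈ S, ¬ X ≤ H) :
    ∃ x ∈ X, ∀ H ∈ S, x ∉ H := by
  classical
  let V : AffineSubspace ℂ E → Subspace ℂ X.direction := fun H =>
    LinearMap.ker ((φ H : E →ₗ[ℂ] ℂ).comp X.direction.subtype)
  have hne : ⊤ ∉ hS.toFinset.image V := by
    intro h
    obtain ⟨H, hH, hV⟩ := Finset.mem_image.1 h
    have hH' := hS.mem_toFinset.1 hH
    refine hX H hH' fun x hx => (hφ H hH' x).2 ?_
    have : (⟨x - p, AffineSubspace.vsub_mem_direction hx hp⟩ : X.direction) ∈ V H := by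
      rw [hV]
      trivial
    exact this
  have h := Subspace.biUnion_ne_univ_of_top_notMem hne
  obtain ⟨v, hv⟩ := (Set.ne_univ_iff_exists_notMem _).1 h
  refine ⟨v + p, AffineSubspace.vadd_mem_of_mem_direction v.2 hp, fun H hH hx => hv ?_⟩
  refine Set.mem_biUnion (x := V H)
    (Finset.mem_coe.2 (Finset.mem_image_of_mem V (hS.mem_toFinset.2 hH))) ?_
  have := (hφ H hH _).1 hx
  rw [add_sub_cancel_right] at this
  exact this

theorem exists_ball_forall_notMem {S : Set (AffineSubspace ℂ E)} (hS : S.Finite) {p : E}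
    (hcut : ∀ H ∈ S, ∃ (φ : E →L[ℂ] ℂ) (q : E), CutsOut φ q H) (hp : p ∈ avoiding S) :
    ∃ r > 0, ∀ H ∈ S, ∀ x ∈ Metric.ball p r, x ∉ H := by
  have hopen : ∀ H ∈ S, ∀ᶠ x in 𝓝 p, x ∉ H := by
    intro H hH
    obtain ⟨φ, q, hφ⟩ := hcut H hH
    have h : ∀ᶠ x in 𝓝 p, φ (x - q) ≠ 0 :=
      (Continuous.continuousAt (by fun_prop)).eventually_ne fun h => hp H hH ((hφ p).2 h)
    exact h.mono fun x hx hxH => hx ((hφ x).1 hxH)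
  obtain ⟨r, hr, h⟩ := Metric.eventually_nhds_iff_ball.1 ((hS.eventually_all).2 hopen)
  exact ⟨r, hr, fun H hH x hx => h x hx H hH⟩

/-- The nonvanishing function on a complement given by a functional cutting out a hyperplane. -/
noncomputable def hyperplaneValue (S : Set (AffineSubspace ℂ E)) {φ : E →L[ℂ] ℂ} {p : E}
    {H : AffineSubspace ℂ E} (hφ : CutsOut φ p H) (hH : H ∈ S) :
    C(avoiding S, {z : ℂ // z ≠ 0}) where
  toFun x := ⟨φ ((x : E) - p), fun h => x.2 H hH ((hφ x).2 h)⟩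
  continuous_toFun := by fun_prop

/-- Since `q ∈ H`, the functional restricted to the meridian traces the circle of radius vector `φ
v` around `0` exactly once. -/
theorem winding_meridian {S : Set (AffineSubspace ℂ E)} {φ : E →L[ℂ] ℂ} {p : E}
    {H : AffineSubspace ℂ E} (hφ : CutsOut φ p H) (hH : H ∈ S) {x₀ y : avoiding S}
    {w : FundamentalGroup {z : ℂ // z ≠ 0} (hyperplaneValue S hφ hH x₀) →* Multiplicative ℤ}
    (hw : ∀ (y : {z : ℂ // z ≠ 0}) (γ : Path (hyperplaneValue S hφ hH x₀) y) (β : Path y y),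
      (∀ t, (β t : ℂ) = Complex.exp (2 * Real.pi * Complex.I * ((t : ℝ) : ℂ)) * y) →
        w (FundamentalGroup.fromPath (.mk ((γ.trans β).trans γ.symm))) = Multiplicative.ofAdd 1)
    (γ : Path x₀ y) (β : Path y y) {q v : E} (hq : q ∈ H)
    (hβ : ∀ t : I, (β t : E) = q + Complex.exp (2 * Real.pi * Complex.I * ((t : ℝ) : ℂ)) • v) :
    w (FundamentalGroup.map (hyperplaneValue S hφ hH) x₀
      (FundamentalGroup.fromPath (.mk ((γ.trans β).trans γ.symm)))) =
        Multiplicative.ofAdd 1 := by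
  let f := hyperplaneValue S hφ hH
  have hval : ∀ t : I, (f (β t) : ℂ) =
      Complex.exp (2 * Real.pi * Complex.I * ((t : ℝ) : ℂ)) * φ v := by
    intro t
    change φ ((β t : E) - p) = _
    rw [hβ, add_sub_right_comm, map_add, map_smul, (hφ q).1 hq, zero_add, smul_eq_mul]
  have hy : (f y : ℂ) = φ v := by
    have := hval 0
    rw [β.source] at this
    simpa using this
  rw [← hw (f y) (γ.map f.continuous) (β.map f.continuous) fun t => (hval t).trans (by rw [hy])]
  congr 1
  change Path.Homotopic.Quotient.mk (((γ.trans β).trans γ.symm).map f.continuous) =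
    Path.Homotopic.Quotient.mk _
  rw [Path.map_trans, Path.map_trans, Path.map_symm]

theorem map_meridian_eq_one {S T : Set (AffineSubspace ℂ E)} (ι : C(avoiding S, avoiding T))
    (hι : ∀ x, (ι x : E) = x) {x₀ y : avoiding S} (γ : Path x₀ y) (β : Path y y) {q v : E}
    (hβ : ∀ t : I, (β t : E) = q + Complex.exp (2 * Real.pi * Complex.I * ((t : ℝ) : ℂ)) • v)
    (hdisk : ∀ z : ℂ, ‖z‖ ≤ 1 → q + z • v ∈ avoiding T) :
    FundamentalGroup.map ι x₀ (FundamentalGroup.fromPath (.mk ((γ.trans β).trans γ.symm))) =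
      1 := by
  let D : C(Metric.closedBall (0 : ℂ) 1, avoiding T) :=
    { toFun := fun z => ⟨q + (z : ℂ) • v, hdisk z (mem_closedBall_zero_iff.1 z.2)⟩
      continuous_toFun := by fun_prop }
  exact FundamentalGroup.map_lasso_eq_one ι γ β
    (Path.homotopic_refl_of_disk D _ fun t => Subtype.ext ((hι _).trans (hβ t)))

theorem CutsOut.mem {φ : E →L[ℂ] ℂ} {p : E} {H : AffineSubspace ℂ E} (hφ : CutsOut φ p H) :
    p ∈ H := (hφ p).2 (by simp)

theorem CutsOut.mem_direction_iff {φ : E →L[ℂ] ℂ} {p : E} {H : AffineSubspace ℂ E}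
    (hφ : CutsOut φ p H) (v : E) : v ∈ H.direction ↔ φ v = 0 := by
  rw [← AffineSubspace.vadd_mem_iff_mem_direction v hφ.mem, hφ, vadd_eq_add, add_sub_cancel_right]

theorem CutsOut.of_mem {φ : E →L[ℂ] ℂ} {p p' : E} {H : AffineSubspace ℂ E}
    (hφ : CutsOut φ p H) (hp' : p' ∈ H) : CutsOut φ p' H := by
  intro x
  rw [hφ, ← sub_add_sub_cancel x p' p, map_add, (hφ p').1 hp', add_zero]

end Avoiding

/-! ### Linear algebra of hyperplanes and rank-two flats. -/

namespace AffineArrangement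

variable {ℓ : ℕ} {A : AffineArrangement ℓ}

theorem exists_cutsOut {H : AffineSubspace ℂ (EuclideanSpace ℂ (Fin ℓ))} (hH : H ∈ A.hyperplanes)
    {p : EuclideanSpace ℂ (Fin ℓ)} (hp : p ∈ H) :
    ∃ φ : EuclideanSpace ℂ (Fin ℓ) →L[ℂ] ℂ, CutsOut φ p H := by
  have hfin : Module.finrank ℂ (EuclideanSpace ℂ (Fin ℓ)) = ℓ := finrank_euclideanSpace_fin
  have hlt : H.direction < ⊤ := by
    refine lt_top_iff_ne_top.2 fun h => ?_
    have := A.codim_one H hH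
    rw [h, finrank_top, hfin] at this
    omega
  obtain ⟨f, hf, hle⟩ := Submodule.exists_le_ker_of_lt_top _ hlt
  have hker : H.direction = LinearMap.ker f := by
    refine Submodule.eq_of_le_of_finrank_eq hle ?_
    have h1 := Module.Dual.finrank_ker_add_one_of_ne_zero (f := f) hf
    have h2 := A.codim_one H hH
    omega
  refine ⟨LinearMap.toContinuousLinearMap f, fun x => ?_⟩
  rw [← AffineSubspace.vsub_right_mem_direction_iff_mem hp, hker]
  rfl

theorem exists_dual_vector {φ ψ : EuclideanSpace ℂ (Fin ℓ) →L[ℂ] ℂ} {p : EuclideanSpace ℂ (Fin ℓ)}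
    {H K : AffineSubspace ℂ (EuclideanSpace ℂ (Fin ℓ))}
    (hH : H ∈ A.hyperplanes) (hK : K ∈ A.hyperplanes) (hφ : CutsOut φ p H) (hψ : CutsOut ψ p K)
    (hne : K ≠ H) : ∃ u, φ u = 1 ∧ ψ u = 0 := by
  have hle : ¬ K.direction ≤ H.direction := by
    intro hle
    have h : K.direction = H.direction := Submodule.eq_of_le_of_finrank_eq hle (by
      have h1 := A.codim_one H hH
      have h2 := A.codim_one K hK
      omega)
    exact hne (AffineSubspace.ext_of_direction_eq h ⟨p, hψ.mem, hφ.mem⟩)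
  obtain ⟨v, hvK, hvH⟩ := SetLike.not_le_iff_exists.1 hle
  rw [hψ.mem_direction_iff] at hvK
  rw [hφ.mem_direction_iff] at hvH
  exact ⟨(φ v)⁻¹ • v, by simp [hvH], by simp [hvK]⟩

theorem exists_vector_eq_one {φ : EuclideanSpace ℂ (Fin ℓ) →L[ℂ] ℂ} {p : EuclideanSpace ℂ (Fin ℓ)}
    {H : AffineSubspace ℂ (EuclideanSpace ℂ (Fin ℓ))}
    (hH : H ∈ A.hyperplanes) (hφ : CutsOut φ p H) : ∃ u, φ u = 1 := by
  by_contra! h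
  have htop : H.direction = ⊤ := by
    refine eq_top_iff.2 fun v _ => (hφ.mem_direction_iff v).2 ?_
    by_contra hv
    exact h ((φ v)⁻¹ • v) (by simp [hv])
  have hfin : Module.finrank ℂ (EuclideanSpace ℂ (Fin ℓ)) = ℓ := finrank_euclideanSpace_fin
  have := A.codim_one H hH
  rw [htop, finrank_top, hfin] at this
  omega

theorem finrank_direction_inf {p : EuclideanSpace ℂ (Fin ℓ)}
    {H K : AffineSubspace ℂ (EuclideanSpace ℂ (Fin ℓ))} (hH : H ∈ A.hyperplanes)
    (hK : K ∈ A.hyperplanes) (hpH : p ∈ H) (hpK : p ∈ K) (hne : H ≠ K) :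
    Module.finrank ℂ (H ⊓ K).direction + 2 = ℓ := by
  have hfin : Module.finrank ℂ (EuclideanSpace ℂ (Fin ℓ)) = ℓ := finrank_euclideanSpace_fin
  have h1 := A.codim_one H hH
  have h2 := A.codim_one K hK
  rw [AffineSubspace.direction_inf_of_mem hpH hpK]
  have h3 := Submodule.finrank_sup_add_finrank_inf_eq H.direction K.direction
  have h4 : Module.finrank ℂ
      (H.direction ⊔ K.direction : Submodule ℂ (EuclideanSpace ℂ (Fin ℓ))) ≤ ℓ :=
    (Submodule.finrank_le _).trans hfin.le
  have h5 : Module.finrank ℂ H.direction <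
      Module.finrank ℂ (H.direction ⊔ K.direction : Submodule ℂ (EuclideanSpace ℂ (Fin ℓ))) := by
    refine Submodule.finrank_lt_finrank_of_lt (lt_of_le_of_ne le_sup_left fun h => hne ?_)
    refine AffineSubspace.ext_of_direction_eq ?_ ⟨p, hpH, hpK⟩
    exact (Submodule.eq_of_le_of_finrank_eq (le_sup_right.trans h.ge) (by omega)).symm
  omega

theorem inf_mem_rankTwoFlats {p : EuclideanSpace ℂ (Fin ℓ)}
    {H K : AffineSubspace ℂ (EuclideanSpace ℂ (Fin ℓ))} (hH : H ∈ A.hyperplanes)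
    (hK : K ∈ A.hyperplanes) (hpH : p ∈ H) (hpK : p ∈ K) (hne : H ≠ K) :
    H ⊓ K ∈ A.rankTwoFlats := by
  refine ⟨⟨⟨p, hpH, hpK⟩, {H, K}, ?_, sInf_pair.symm⟩, ?_⟩
  · rintro _ (rfl | rfl) <;> assumption
  · have := finrank_direction_inf hH hK hpH hpK hne
    unfold codim
    omega

/-- Uniqueness by dimension: `H ⊓ K` already has codimension two. Hence two different rank-two flats
share at most one hyperplane. -/
theorem eq_inf_of_mem_rankTwoFlats {p : EuclideanSpace ℂ (Fin ℓ)}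
    {H K X : AffineSubspace ℂ (EuclideanSpace ℂ (Fin ℓ))} (hH : H ∈ A.hyperplanes)
    (hK : K ∈ A.hyperplanes) (hpH : p ∈ H) (hpK : p ∈ K) (hne : H ≠ K) (hX : X ∈ A.rankTwoFlats)
    (hXH : X ≤ H) (hXK : X ≤ K) : X = H ⊓ K := by
  have h1 := finrank_direction_inf hH hK hpH hpK hne
  have h2 : ℓ - Module.finrank ℂ X.direction = 2 := hX.2
  have hle : X ≤ H ⊓ K := le_inf hXH hXK
  refine AffineSubspace.eq_of_direction_eq_of_nonempty_of_le ?_ hX.1.1 hle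
  exact Submodule.eq_of_le_of_finrank_eq (AffineSubspace.direction_le hle) (by omega)

theorem mem_of_mem_flats {p : EuclideanSpace ℂ (Fin ℓ)} (hp : ∀ H ∈ A.hyperplanes, p ∈ H)
    {X : AffineSubspace ℂ (EuclideanSpace ℂ (Fin ℓ))}
    (hX : X ∈ A.flats) : p ∈ X := by
  obtain ⟨_, B, hB, rfl⟩ := hX
  exact (AffineSubspace.mem_sInf_iff _ _).2 fun H hH => hp H (hB hH)

theorem finite_rankTwoFlats : A.rankTwoFlats.Finite := by
  refine (A.finite.finite_subsets.image sInf).subset ?_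
  rintro X ⟨⟨_, B, hB, rfl⟩, _⟩
  exact ⟨B, hB, rfl⟩

/-- At most two distinct hyperplanes through a point have independent functionals, so dual vectors
exist. -/
theorem commute_of_ncard_le_two {p : EuclideanSpace ℂ (Fin ℓ)}
    {φ : AffineSubspace ℂ (EuclideanSpace ℂ (Fin ℓ)) → EuclideanSpace ℂ (Fin ℓ) →L[ℂ] ℂ}
    (hφ : ∀ H ∈ A.hyperplanes, CutsOut (φ H) p H)
    {T : Set (AffineSubspace ℂ (EuclideanSpace ℂ (Fin ℓ)))}
    (hT : T ⊆ A.hyperplanes) (hcard : T.ncard ≤ 2) (e : avoiding T)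
    (a b : FundamentalGroup (avoiding T) e) : Commute a b := by
  have hfin := A.finite.subset hT
  have hu : ∀ H, ∃ u, H ∈ T → φ H u = 1 ∧ ∀ K ∈ T, K ≠ H → φ K u = 0 := by
    intro H
    by_cases hH : H ∈ T
    swap
    · exact ⟨0, fun h => absurd h hH⟩
    by_cases hK : ∃ K ∈ T, K ≠ H
    · obtain ⟨K, hK, hne⟩ := hK
      obtain ⟨u, hu, hu'⟩ := exists_dual_vector (hT hH) (hT hK) (hφ H (hT hH)) (hφ K (hT hK)) hne
      refine ⟨u, fun _ => ⟨hu, fun K' hK' hne' => ?_⟩⟩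
      by_cases h : K' = K
      · rwa [h]
      · have := (Set.two_lt_ncard_iff hfin).2 ⟨H, K, K', hH, hK, hK', hne.symm, hne'.symm,
          fun h' => h h'.symm⟩
        omega
    · push Not at hK
      obtain ⟨u, hu⟩ := exists_vector_eq_one (hT hH) (hφ H (hT hH))
      exact ⟨u, fun _ => ⟨hu, fun K hK' hne => absurd (hK K hK') hne⟩⟩
  choose u hu using hu
  exact commute_fundamentalGroup_avoiding hfin p φ (fun H hH => hφ H (hT hH)) u
    (fun H hH => (hu H hH).1) (fun H hH => (hu H hH).2) e a b

end AffineArrangement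

/-! ### Assembly for arrangement groups. -/

namespace AffineArrangement

variable {ℓ : ℕ} {A : AffineArrangement ℓ}

/-- The local sections of the maps `ρ_X`. -/
theorem exists_section_rhoAt (x₀ : A.complement) {p : EuclideanSpace ℂ (Fin ℓ)}
    {φ : AffineSubspace ℂ (EuclideanSpace ℂ (Fin ℓ)) → EuclideanSpace ℂ (Fin ℓ) →L[ℂ] ℂ}
    (hφ : ∀ H ∈ A.hyperplanes, CutsOut (φ H) p H)
    {X : AffineSubspace ℂ (EuclideanSpace ℂ (Fin ℓ))} (hX : X ∈ A.rankTwoFlats) :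
    ∃ s : A.LocalGrp x₀ X →* A.Grp x₀,
      (∃ l, ∀ q, A.rhoAt x₀ X (s q) = l * q * l⁻¹) ∧
      (∀ Y ∈ A.rankTwoFlats, X ≠ Y → ∀ q q',
        Commute (A.rhoAt x₀ Y (s q)) (A.rhoAt x₀ Y (s q'))) ∧
      ∀ (H) (hH : H ∈ A.hyperplanes), ¬ X ≤ H → ∀ q,
        FundamentalGroup.map (hyperplaneValue A.hyperplanes (hφ H hH) hH) x₀ (s q) = 1 := by
  have hpX : p ∈ X := mem_of_mem_flats (fun H hH => (hφ H hH).mem) hX.1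
  have hfin : (A.hyperplanes \ (A.localization X).hyperplanes).Finite := A.finite.sdiff
  obtain ⟨p', hp'X, hp'⟩ := exists_mem_forall_notMem hfin hpX φ (fun H hH => hφ H hH.1)
    (fun H hH hle => hH.2 ⟨hH.1, hle⟩)
  obtain ⟨r, hr, hball⟩ := exists_ball_forall_notMem hfin (fun H hH => ⟨_, _, hφ H hH.1⟩) hp'
  obtain ⟨s, h1, h2, h3⟩ := exists_localSection A.finite (fun H hH => ⟨_, _, hφ H hH⟩) p' φ
    (T := (A.localization X).hyperplanes)
    (fun H hH => (hφ H hH.1).of_mem (hH.2 hp'X)) hr (fun H hH hT => hball H ⟨hH, hT⟩) x₀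
    (A.inclusion X) (fun _ => rfl)
  refine ⟨s, h1, fun Y hY hne => ?_, fun H hH hXH => ?_⟩
  · refine h2 (A.localization Y).hyperplanes (fun H hH => hH.1) ?_ (A.inclusion Y) (fun _ => rfl)
    refine commute_of_ncard_le_two hφ (fun H hH => hH.1.1) ?_
    -- Distinct rank-two flats have at most one common hyperplane, so the intermediate complement
    -- has commutative fundamental group.
    refine (Set.ncard_le_one_iff (A.finite.subset fun H hH => hH.1.1)).2 ?_ |>.trans one_le_two
    intro H K hH hK
    by_contra hHK
    have hpH := (hφ H hH.1.1).mem
    have hpK := (hφ K hK.1.1).mem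
    exact hne ((eq_inf_of_mem_rankTwoFlats hH.1.1 hK.1.1 hpH hpK hHK hX hH.1.2 hK.1.2).trans
      (eq_inf_of_mem_rankTwoFlats hH.1.1 hK.1.1 hpH hpK hHK hY hH.2.2 hK.2.2).symm)
  · exact h3 H hH (fun h => hXH h.2) _ _ (hφ H hH) _ (fun _ => rfl)

/-- Any two hyperplanes of `A_X` cut out `X`, so their functionals serve as the two coordinates of
the rank-two arrangement. -/
theorem nilpotentResidue_localGrp (x₀ : A.complement) {p : EuclideanSpace ℂ (Fin ℓ)}
    {φ : AffineSubspace ℂ (EuclideanSpace ℂ (Fin ℓ)) → EuclideanSpace ℂ (Fin ℓ) →L[ℂ] ℂ}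
    (hφ : ∀ H ∈ A.hyperplanes, CutsOut (φ H) p H)
    {X : AffineSubspace ℂ (EuclideanSpace ℂ (Fin ℓ))} (hX : X ∈ A.multipleRankTwoFlats) :
    LowerCentral.nilpotentResidue (A.LocalGrp x₀ X) = ⊥ := by
  obtain ⟨hX, hcard⟩ := hX
  have hfin := (A.localization X).finite
  obtain ⟨H₀, H₁, _, h₀, h₁, _, hne, _, _⟩ := (Set.two_lt_ncard_iff hfin).1 hcard
  have hX' := eq_inf_of_mem_rankTwoFlats h₀.1 h₁.1 (hφ _ h₀.1).mem (hφ _ h₁.1).mem hne hX h₀.2 h₁.2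
  obtain ⟨u₀, h00, h10⟩ := exists_dual_vector h₀.1 h₁.1 (hφ _ h₀.1) (hφ _ h₁.1) hne.symm
  obtain ⟨u₁, h11, h01⟩ := exists_dual_vector h₁.1 h₀.1 (hφ _ h₁.1) (hφ _ h₀.1) hne
  refine nilpotentResidue_avoiding hfin p φ (fun H hH => hφ H hH.1) h₀ h00 h01 h10 h11 ?_ ?_ _
  · intro H hH v hv₀ hv₁
    rw [← (hφ H hH.1).mem_direction_iff]
    refine AffineSubspace.direction_le hH.2 ?_
    rw [hX', AffineSubspace.direction_inf_of_mem (hφ _ h₀.1).mem (hφ _ h₁.1).mem]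
    exact ⟨((hφ _ h₀.1).mem_direction_iff v).2 hv₀, ((hφ _ h₁.1).mem_direction_iff v).2 hv₁⟩
  · intro H hH hle
    by_contra hH₀
    obtain ⟨u, hu, hu'⟩ := exists_dual_vector hH.1 h₀.1 (hφ _ hH.1) (hφ _ h₀.1) (Ne.symm hH₀)
    rw [hle u hu'] at hu
    exact zero_ne_one hu

theorem mem_nilpotentResidue_of_forall_rhoAt (x₀ : A.complement) {p : EuclideanSpace ℂ (Fin ℓ)}
    {φ : AffineSubspace ℂ (EuclideanSpace ℂ (Fin ℓ)) → EuclideanSpace ℂ (Fin ℓ) →L[ℂ] ℂ}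
    (hφ : ∀ H ∈ A.hyperplanes, CutsOut (φ H) p H) (hdec : A.IsDecomposable x₀)
    (hcover : A.Covers A.multipleRankTwoFlats) {a : A.hyperplanes → A.Grp x₀}
    (ha : A.IsStandardGeneratingSet x₀ a) {g : A.Grp x₀}
    (hg : ∀ X ∈ A.multipleRankTwoFlats, A.rhoAt x₀ X g = 1) :
    g ∈ LowerCentral.nilpotentResidue (A.Grp x₀) := by
  classical
  have hmer : ∀ H : A.hyperplanes, ∃ (q v : EuclideanSpace ℂ (Fin ℓ)) (y : A.complement)
      (γ : Path x₀ y) (β : Path y y), q ∈ H.1 ∧ a H = A.lasso γ β ∧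
      (∀ z : ℂ, ‖z‖ ≤ 1 → ∀ K ∈ A.hyperplanes, K ≠ H → q + z • v ∉ K) ∧
      ∀ t : I, (β t : EuclideanSpace ℂ (Fin ℓ)) =
        q + Complex.exp (2 * Real.pi * Complex.I * ((t : ℝ) : ℂ)) • v := by
    intro H
    obtain ⟨X, _, _, _, r, y, γ, β, _, ⟨q, v, hq, _, hdisk, hβ⟩, haH⟩ := ha.1 H
    exact ⟨q, v, y, γ, β, hq, haH, fun z hz => (hdisk z hz).2, hβ⟩
  choose q v y γ β hq haH hdisk hβ using hmer
  let f : ∀ H : A.hyperplanes, C(A.complement, {z : ℂ // z ≠ 0}) := fun H =>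
    hyperplaneValue A.hyperplanes (hφ H H.2) H.2
  choose W hW using fun H : A.hyperplanes => exists_winding_hom (f H x₀)
  have : Fintype A.rankTwoFlats := finite_rankTwoFlats.fintype
  have : Finite A.hyperplanes := A.finite
  choose s hs using fun X : A.rankTwoFlats => exists_section_rhoAt x₀ hφ X.2
  have hρa : ∀ (T : Set (AffineSubspace ℂ (EuclideanSpace ℂ (Fin ℓ)))) (_ : T ⊆ A.hyperplanes)
      (ι : C(A.complement, avoiding T)) (_ : ∀ x, (ι x : EuclideanSpace ℂ (Fin ℓ)) = x)
      (H : A.hyperplanes), H.1 ∉ T → FundamentalGroup.map ι x₀ (a H) = 1 := by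
    intro T hT ι hι H hH
    rw [haH]
    exact map_meridian_eq_one (S := A.hyperplanes) ι hι (γ H) (β H) (hβ H)
      (fun z hz K hK => hdisk H z hz K (hT hK) fun h => hH (h ▸ hK))
  refine LowerCentral.mem_nilpotentResidue_of_local a ha.2 (fun X => A.rhoAt x₀ X.1) s
    (fun X => {H | X.1 ≤ H.1}) (fun H => (W H).comp (FundamentalGroup.map (f H) x₀))
    ?_ ?_ ?_ ?_ (fun X => (hs X).1)
    (fun X Y hXY => (hs X).2.1 Y Y.2 (Subtype.coe_injective.ne hXY)) ?_
    {X | X.1 ∈ A.multipleRankTwoFlats} ?_ ?_ ?_ (fun X hX => hg X hX)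
  · intro H K
    by_cases h : H = K
    · subst h
      rw [if_pos rfl, MonoidHom.comp_apply, haH]
      exact winding_meridian (hφ H H.2) H.2 (hW H) (γ H) (β H) (hq H) (hβ H)
    · rw [if_neg h, MonoidHom.comp_apply]
      -- The winding number about `H` factors through the complement of `H` alone, where a meridian
      -- of another hyperplane bounds a disc.
      let ι : C(A.complement, avoiding {H.1}) :=
        { toFun := fun x => ⟨x, by
            rintro _ rfl
            exact x.2 H H.2⟩
          continuous_toFun := by fun_prop }
      have h1 := hρa {H.1} (Set.singleton_subset_iff.2 H.2) ι (fun _ => rfl) K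
        (fun h' => h (Subtype.ext h'.symm))
      have h2 := FundamentalGroup.map_comp_apply ι
        (hyperplaneValue {H.1} (hφ H H.2) (Set.mem_singleton _)) x₀ (a K)
      rw [h1, map_one] at h2
      exact (congrArg (W H) h2).trans (map_one (W H))
  · intro X H hH
    exact hρa (A.localization X).hyperplanes (fun K hK => hK.1) (A.inclusion X) (fun _ => rfl) H
      (fun h => hH h.2)
  · intro X H hH x
    rw [MonoidHom.comp_apply]
    exact (congrArg (W H) ((hs X).2.2 H H.2 hH x)).trans (map_one (W H))
  · intro X H hH
    let f' : C((A.localization X).complement, {z : ℂ // z ≠ 0}) :=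
      hyperplaneValue (A.localization X).hyperplanes (hφ H H.2) ⟨H.2, hH⟩
    exact ⟨(W H).comp (FundamentalGroup.map f' (A.inclusion X x₀)), fun g =>
      congrArg (W H) (FundamentalGroup.map_comp_apply (A.inclusion X) f' x₀ g)⟩
  · intro H K hne
    have hpH := (hφ H H.2).mem
    have hpK := (hφ K K.2).mem
    have hne' : H.1 ≠ K.1 := Subtype.coe_injective.ne hne
    refine ⟨⟨_, inf_mem_rankTwoFlats H.2 K.2 hpH hpK hne'⟩,
      ⟨(inf_le_left : H.1 ⊓ K.1 ≤ H.1), (inf_le_right : H.1 ⊓ K.1 ≤ K.1)⟩, ?_⟩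
    intro X hX
    exact Subtype.ext (eq_inf_of_mem_rankTwoFlats H.2 K.2 hpH hpK hne' X.2 hX.1 hX.2)
  · intro X hX
    refine commute_of_ncard_le_two hφ (T := (A.localization X).hyperplanes) (fun H hH => hH.1) ?_ _
    by_contra h
    exact hX ⟨X.2, by omega⟩
  · intro H
    obtain ⟨X, hX, hXH⟩ := hcover H H.2
    exact ⟨⟨X, hX.1⟩, hX, hXH.2⟩
  · intro i hi p hp
    have : Fact p.Prime := ⟨hp⟩
    -- Index `i` is degree `i + 1`, so `2 ≤ i` matches decomposability from degree three on.
    exact (hdec (ZMod p) (i + 1) (by omega)).1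

end AffineArrangement

theorem mainTheorem12 {ℓ : ℕ} (A : AffineArrangement ℓ) (x₀ : A.complement)
    (hcentral : A.IsCentral) (hrank : 3 ≤ A.centralRank)
    (hdec : A.IsDecomposable x₀)
    (hcover : A.Covers A.multipleRankTwoFlats)
    (hadapted : ∃ a : A.hyperplanes → A.Grp x₀,
      A.IsStandardGeneratingSet x₀ a ∧ A.IsAdaptedTo x₀ a A.multipleRankTwoFlats) :
    (A.rho x₀ A.multipleRankTwoFlats).ker = LowerCentral.nilpotentResidue (A.Grp x₀) := by
  obtain ⟨p, hp⟩ := hcentral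
  obtain ⟨a, ha, -⟩ := hadapted
  have hφ : ∀ H, ∃ φ : EuclideanSpace ℂ (Fin ℓ) →L[ℂ] ℂ, H ∈ A.hyperplanes → CutsOut φ p H := by
    intro H
    by_cases hH : H ∈ A.hyperplanes
    · obtain ⟨φ, hφ⟩ := AffineArrangement.exists_cutsOut hH (hp H hH)
      exact ⟨φ, fun _ => hφ⟩
    · exact ⟨0, fun h => absurd h hH⟩
  choose φ hφ using hφ
  refine le_antisymm (fun g hg => ?_) (fun g hg => ?_)
  · exact AffineArrangement.mem_nilpotentResidue_of_forall_rhoAt x₀ hφ hdec hcover ha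
      fun X hX => congrFun (MonoidHom.mem_ker.1 hg) ⟨X, hX⟩
  · refine MonoidHom.mem_ker.2 (funext fun X => ?_)
    have h := LowerCentral.map_mem_nilpotentResidue (A.rhoAt x₀ X.1) hg
    rw [AffineArrangement.nilpotentResidue_localGrp x₀ hφ X.2] at h
    exact Subgroup.mem_bot.1 h
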